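/- A (real) Banach lattice $X$ has the positive Schur property (PSP) if every weakly null sequence of positive elements of $X$ is norm null. The topological dual $X^*$ of a Banach lattice $X$ carries the dual norm and the order $f\le g \iff f(x)\le g(x)$ for all $x\ge 0$. Let $m\ge 1$ and let $E_1,\dots,E_m$ be nonzero Banach lattices. Let $E_1\bar\otimes\cdots\bar\otimes E_m$ be their (Fremlin) vector lattice tensor product, that is, the Archimedean vector lattice together with an $m$-linear map $\otimes$ satisfying $|x_1\otimes\cdots\otimes x_m|=|x_1|\otimes\cdots\otimes|x_m|$ (an $m$-morphism) such that every $m$-morphism from $E_1\times\cdots\times E_m$ into an Archimedean vector lattice factors uniquely through $\otimes$ by a linear lattice homomorphism. Let $E_1\hat\otimes_{|\pi|}\cdots\hat\otimes_{|\pi|}E_m$ be its completion with respect to the positive projective tensor norm $$\|u\|_{|\pi|}=\inf\Big\{\sum_{k=1}^n\|x_{1,k}\|\cdots\|x_{m,k}\| : n\in\mathbb N,\ x_{i,k}\in E_i,\ x_{i,k}\ge 0,\ |u|\le\sum_{k=1}^n x_{1,k}\otimes\cdots\otimes x_{m,k}\Big\}.$$ Proposition 4.3. The dual $(E_1\hat\otimes_{|\pi|}\cdots\hat\otimes_{|\pi|}E_m)^*$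 has the PSP if and only if each of $E_1^*,\dots,E_m^*$ has the PSP. -/

import Mathlib

open Filter Topology

universe u

/-! ### Vector lattices, `m`-morphisms, the positive Schur property

A (real) vector lattice is a type with `AddCommGroup`, `Module ℝ`, `Lattice`, `IsOrderedAddMonoid`
and `IsOrderedModule ℝ`; a Banach lattice is moreover `NormedAddCommGroup`, `NormedSpace ℝ`,
`HasSolidNorm` and `CompleteSpace`. -/

/-- A vector lattice is Archimedean if `n u ≤ v` for all `n` implies `u ≤ 0`.
(Mathlib's `Archimedean` is meant for linear orders and is a different notion here.) -/
def IsArchimedeanLattice (G : Type*) [AddCommGroup G] [Lattice G] : Prop :=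
  ∀ u v : G, (∀ n : ℕ, n • u ≤ v) → u ≤ 0

/-- An `m`-linear map `T` between vector lattices is an `m`-morphism if
`|T (x₁, …, xₘ)| = T (|x₁|, …, |xₘ|)`. -/
def IsMMorphism {ι : Type} {E : ι → Type*} {G : Type*}
    [∀ i, AddCommGroup (E i)] [∀ i, Module ℝ (E i)] [∀ i, Lattice (E i)]
    [AddCommGroup G] [Module ℝ G] [Lattice G] (T : MultilinearMap ℝ E G) : Prop :=
  ∀ x : (∀ i, E i), |T x| = T (fun i => |x i|)

/-- The positive Schur property: every weakly null sequence of positive elements is norm null. -/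
def HasPositiveSchurProperty (X : Type*) [NormedAddCommGroup X] [NormedSpace ℝ X]
    [PartialOrder X] : Prop :=
  ∀ x : ℕ → X, (∀ n, 0 ≤ x n) →
    (∀ f : StrongDual ℝ X, Tendsto (fun n => f (x n)) atTop (𝓝 0)) →
    Tendsto (fun n => ‖x n‖) atTop (𝓝 0)

/-- The order of the topological dual of a normed vector lattice: `f ≤ g` iff `f x ≤ g x` for all
`x ≥ 0`. -/
instance StrongDual.instPartialOrderOfLattice {X : Type*} [NormedAddCommGroup X] [NormedSpace ℝ X]
    [Lattice X] [IsOrderedAddMonoid X] : PartialOrder (StrongDual ℝ X) where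
  le f g := ∀ x : X, 0 ≤ x → f x ≤ g x
  le_refl _ _ _ := le_rfl
  le_trans _ _ _ h₁ h₂ x hx := (h₁ x hx).trans (h₂ x hx)
  le_antisymm f g h₁ h₂ := by
    have key : ∀ x : X, 0 ≤ x → f x = g x := fun x hx => le_antisymm (h₁ x hx) (h₂ x hx)
    ext x
    rw [← posPart_sub_negPart x, map_sub, map_sub, key _ (posPart_nonneg x),
      key _ (negPart_nonneg x)]

/-! ### The vector lattice tensor product

The Archimedean vector lattice generated by symbols `x₁ ⊗ ⋯ ⊗ xₘ`, subject exactly to the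
identities that hold under all `m`-morphisms into Archimedean vector lattices. -/

/-- Formal vector lattice expressions in the symbols `x₁ ⊗ ⋯ ⊗ xₘ`. -/
inductive TensorTerm {ι : Type} (E : ι → Type u) : Type u
  | tmul (x : ∀ i, E i) : TensorTerm E
  | zero : TensorTerm E
  | add (s t : TensorTerm E) : TensorTerm E
  | neg (s : TensorTerm E) : TensorTerm E
  | smul (c : ℝ) (s : TensorTerm E) : TensorTerm E
  | sup (s t : TensorTerm E) : TensorTerm E
  | inf (s t : TensorTerm E) : TensorTerm E

/-- The value of an expression when `x₁ ⊗ ⋯ ⊗ xₘ` is interpreted as `φ (x₁, …, xₘ)`. -/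
def TensorTerm.eval {ι : Type} {E : ι → Type u} {G : Type*} [AddCommGroup G] [Module ℝ G]
    [Lattice G] (φ : (∀ i, E i) → G) : TensorTerm E → G
  | .tmul x => φ x
  | .zero => 0
  | .add s t => s.eval φ + t.eval φ
  | .neg s => -s.eval φ
  | .smul c s => c • s.eval φ
  | .sup s t => s.eval φ ⊔ t.eval φ
  | .inf s t => s.eval φ ⊓ t.eval φ

/-- Two expressions are identified if they agree under every `m`-morphism into an Archimedean
vector lattice. -/
def TensorTerm.setoid {ι : Type} (E : ι → Type u)
    [∀ i, AddCommGroup (E i)] [∀ i, Module ℝ (E i)] [∀ i, Lattice (E i)] :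
    Setoid (TensorTerm E) where
  r s t := ∀ (G : Type u) [AddCommGroup G] [Module ℝ G] [Lattice G] [IsOrderedAddMonoid G]
    [IsOrderedModule ℝ G], IsArchimedeanLattice G → ∀ φ : MultilinearMap ℝ E G, IsMMorphism φ →
      s.eval φ = t.eval φ
  iseqv :=
    { refl := by intros; rfl
      symm := by intro s t h; intros; symm; apply h <;> assumption
      trans := by
        intro s t r h₁ h₂ G _ _ _ _ _ hG φ hφ
        exact (h₁ G hG φ hφ).trans (h₂ G hG φ hφ) }

/-- The vector lattice tensor product `E₁ ⊗̄ ⋯ ⊗̄ Eₘ`. -/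
def VectorLatticeTensor {ι : Type} (E : ι → Type u)
    [∀ i, AddCommGroup (E i)] [∀ i, Module ℝ (E i)] [∀ i, Lattice (E i)] : Type u :=
  Quotient (TensorTerm.setoid E)

namespace VectorLatticeTensor

section Algebra

variable {ι : Type} {E : ι → Type u}
  [∀ i, AddCommGroup (E i)] [∀ i, Module ℝ (E i)] [∀ i, Lattice (E i)]

/-- The class of an expression. -/
def mk (s : TensorTerm E) : VectorLatticeTensor E := Quotient.mk (TensorTerm.setoid E) s

theorem mk_eq {s t : TensorTerm E}
    (h : ∀ (G : Type u) [AddCommGroup G] [Module ℝ G] [Lattice G] [IsOrderedAddMonoid G]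
      [IsOrderedModule ℝ G], IsArchimedeanLattice G → ∀ φ : MultilinearMap ℝ E G, IsMMorphism φ →
        s.eval φ = t.eval φ) : mk s = mk t :=
  Quotient.sound (s := TensorTerm.setoid E) h

theorem exact_mk {s t : TensorTerm E} (h : mk s = mk t)
    (G : Type u) [AddCommGroup G] [Module ℝ G] [Lattice G] [IsOrderedAddMonoid G]
    [IsOrderedModule ℝ G] (hG : IsArchimedeanLattice G) (φ : MultilinearMap ℝ E G)
    (hφ : IsMMorphism φ) : s.eval φ = t.eval φ :=
  (Quotient.exact (s := TensorTerm.setoid E) h : (TensorTerm.setoid E).r s t) G hG φ hφ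

theorem ind {p : VectorLatticeTensor E → Prop} (h : ∀ s, p (mk s)) (a : VectorLatticeTensor E) :
    p a :=
  Quotient.ind (s := TensorTerm.setoid E) h a

instance : Zero (VectorLatticeTensor E) := ⟨mk .zero⟩

instance : Add (VectorLatticeTensor E) :=
  ⟨Quotient.map₂ (sa := TensorTerm.setoid E) (sb := TensorTerm.setoid E)
    (sc := TensorTerm.setoid E) .add (by
      intro a b h c d h' G _ _ _ _ _ hG φ hφ
      exact congrArg₂ (· + ·) (h G hG φ hφ) (h' G hG φ hφ))⟩

instance : Neg (VectorLatticeTensor E) :=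
  ⟨Quotient.map (sa := TensorTerm.setoid E) (sb := TensorTerm.setoid E) .neg (by
      intro a b h G _ _ _ _ _ hG φ hφ
      exact congrArg (fun z => -z) (h G hG φ hφ))⟩

instance : SMul ℝ (VectorLatticeTensor E) :=
  ⟨fun c => Quotient.map (sa := TensorTerm.setoid E) (sb := TensorTerm.setoid E) (.smul c) (by
      intro a b h G _ _ _ _ _ hG φ hφ
      exact congrArg (fun z => c • z) (h G hG φ hφ))⟩

/-- The supremum of two classes. -/
def supAux : VectorLatticeTensor E → VectorLatticeTensor E → VectorLatticeTensor E :=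
  Quotient.map₂ (sa := TensorTerm.setoid E) (sb := TensorTerm.setoid E)
    (sc := TensorTerm.setoid E) .sup (by
      intro a b h c d h' G _ _ _ _ _ hG φ hφ
      exact congrArg₂ (· ⊔ ·) (h G hG φ hφ) (h' G hG φ hφ))

/-- The infimum of two classes. -/
def infAux : VectorLatticeTensor E → VectorLatticeTensor E → VectorLatticeTensor E :=
  Quotient.map₂ (sa := TensorTerm.setoid E) (sb := TensorTerm.setoid E)
    (sc := TensorTerm.setoid E) .inf (by
      intro a b h c d h' G _ _ _ _ _ hG φ hφ
      exact congrArg₂ (· ⊓ ·) (h G hG φ hφ) (h' G hG φ hφ))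

theorem mk_zero : mk .zero = (0 : VectorLatticeTensor E) := rfl
theorem mk_add (s t : TensorTerm E) : mk (.add s t) = mk s + mk t := rfl
theorem mk_neg (s : TensorTerm E) : mk (.neg s) = -mk s := rfl
theorem mk_smul (c : ℝ) (s : TensorTerm E) : mk (.smul c s) = c • mk s := rfl

instance : AddCommGroup (VectorLatticeTensor E) where
  add_assoc a b c := by
    induction a using ind; induction b using ind; induction c using ind
    exact mk_eq fun G _ _ _ _ _ _ φ _ => by simp only [TensorTerm.eval, add_assoc]
  zero_add a := by
    induction a using ind
    exact mk_eq fun G _ _ _ _ _ _ φ _ => by simp only [TensorTerm.eval, zero_add]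
  add_zero a := by
    induction a using ind
    exact mk_eq fun G _ _ _ _ _ _ φ _ => by simp only [TensorTerm.eval, add_zero]
  add_comm a b := by
    induction a using ind; induction b using ind
    exact mk_eq fun G _ _ _ _ _ _ φ _ => by simp only [TensorTerm.eval, add_comm]
  neg_add_cancel a := by
    induction a using ind
    exact mk_eq fun G _ _ _ _ _ _ φ _ => by simp only [TensorTerm.eval, neg_add_cancel]
  nsmul := nsmulRec
  zsmul := zsmulRec

instance : Module ℝ (VectorLatticeTensor E) where
  one_smul a := by
    induction a using ind
    exact mk_eq fun G _ _ _ _ _ _ φ _ => by simp only [TensorTerm.eval, one_smul]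
  mul_smul c d a := by
    induction a using ind
    exact mk_eq fun G _ _ _ _ _ _ φ _ => by simp only [TensorTerm.eval, mul_smul]
  smul_zero c := mk_eq fun G _ _ _ _ _ _ φ _ => by simp only [TensorTerm.eval, smul_zero]
  zero_smul a := by
    induction a using ind
    exact mk_eq fun G _ _ _ _ _ _ φ _ => by simp only [TensorTerm.eval, zero_smul]
  smul_add c a b := by
    induction a using ind; induction b using ind
    exact mk_eq fun G _ _ _ _ _ _ φ _ => by simp only [TensorTerm.eval, smul_add]
  add_smul c d a := by
    induction a using ind
    exact mk_eq fun G _ _ _ _ _ _ φ _ => by simp only [TensorTerm.eval, add_smul]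

/-- In the resulting order, `a ≤ b` iff `a ⊔ b = b`. -/
instance : Lattice (VectorLatticeTensor E) :=
  @Lattice.mk' _ ⟨supAux⟩ ⟨infAux⟩
    (fun a b => by
      induction a using ind; induction b using ind
      exact mk_eq fun G _ _ _ _ _ _ φ _ => sup_comm _ _)
    (fun a b c => by
      induction a using ind; induction b using ind; induction c using ind
      exact mk_eq fun G _ _ _ _ _ _ φ _ => sup_assoc _ _ _)
    (fun a b => by
      induction a using ind; induction b using ind
      exact mk_eq fun G _ _ _ _ _ _ φ _ => inf_comm _ _)
    (fun a b c => by
      induction a using ind; induction b using ind; induction c using ind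
      exact mk_eq fun G _ _ _ _ _ _ φ _ => inf_assoc _ _ _)
    (fun a b => by
      induction a using ind; induction b using ind
      exact mk_eq fun G _ _ _ _ _ _ φ _ => sup_inf_self)
    (fun a b => by
      induction a using ind; induction b using ind
      exact mk_eq fun G _ _ _ _ _ _ φ _ => inf_sup_self)

theorem mk_sup (s t : TensorTerm E) : mk (.sup s t) = mk s ⊔ mk t := rfl
theorem mk_inf (s t : TensorTerm E) : mk (.inf s t) = mk s ⊓ mk t := rfl

theorem mk_le_mk {s t : TensorTerm E} : mk s ≤ mk t ↔
    ∀ (G : Type u) [AddCommGroup G] [Module ℝ G] [Lattice G] [IsOrderedAddMonoid G]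
      [IsOrderedModule ℝ G], IsArchimedeanLattice G → ∀ φ : MultilinearMap ℝ E G, IsMMorphism φ →
        s.eval φ ≤ t.eval φ := by
  rw [← sup_eq_right, ← mk_sup]
  constructor
  · intro h G _ _ _ _ _ hG φ hφ
    exact sup_eq_right.mp (exact_mk h G hG φ hφ)
  · intro h
    exact mk_eq fun G _ _ _ _ _ hG φ hφ => sup_eq_right.mpr (h G hG φ hφ)

instance : IsOrderedAddMonoid (VectorLatticeTensor E) where
  add_le_add_left a b h c := by
    induction a using ind; induction b using ind; induction c using ind
    rw [← mk_add, ← mk_add, mk_le_mk]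
    rw [mk_le_mk] at h
    intro G _ _ _ _ _ hG φ hφ
    exact add_le_add_left (h G hG φ hφ) _

instance : IsOrderedModule ℝ (VectorLatticeTensor E) :=
  .of_smul_nonneg (fun c hc a ha => by
    induction a using ind
    rw [← mk_zero] at ha ⊢
    rw [← mk_smul]
    rw [mk_le_mk] at ha ⊢
    intro G _ _ _ _ _ hG φ hφ
    exact smul_nonneg hc (ha G hG φ hφ))

/-- The elementary tensor `x₁ ⊗ ⋯ ⊗ xₘ`, as an `m`-linear map in `(x₁, …, xₘ)`. -/
def tmul : MultilinearMap ℝ E (VectorLatticeTensor E) where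
  toFun x := mk (.tmul x)
  map_update_add' x i a b :=
    mk_eq fun G _ _ _ _ _ _ φ _ => by simp only [TensorTerm.eval, φ.map_update_add]
  map_update_smul' x i c a :=
    mk_eq fun G _ _ _ _ _ _ φ _ => by simp only [TensorTerm.eval, φ.map_update_smul]

/-- `⊗` is an `m`-morphism. -/
theorem isMMorphism_tmul : IsMMorphism (tmul (E := E)) := fun x =>
  mk_eq (s := .sup (.tmul x) (.neg (.tmul x))) fun _ _ _ _ _ _ _ _ hφ => hφ x

/-- The vector lattice tensor product is Archimedean. -/
theorem isArchimedeanLattice : IsArchimedeanLattice (VectorLatticeTensor E) := by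
  intro a b h
  induction a using ind with | _ s
  induction b using ind with | _ t
  rw [← mk_zero, mk_le_mk]
  intro G _ _ _ _ _ hG φ hφ
  refine hG _ (t.eval φ) fun n => ?_
  have h' := h n
  rw [← Nat.cast_smul_eq_nsmul ℝ, ← mk_smul, mk_le_mk] at h'
  simpa only [TensorTerm.eval, Nat.cast_smul_eq_nsmul] using h' G hG φ hφ

/-- The universal property of the vector lattice tensor product: every `m`-morphism into an
Archimedean vector lattice factors uniquely through `⊗` by a lattice homomorphism. -/
theorem existsUnique_lift {G : Type u} [AddCommGroup G] [Module ℝ G] [Lattice G]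
    [IsOrderedAddMonoid G] [IsOrderedModule ℝ G] (hG : IsArchimedeanLattice G)
    (φ : MultilinearMap ℝ E G) (hφ : IsMMorphism φ) :
    ∃! T : VectorLatticeTensor E →ₗ[ℝ] G,
      (∀ a b, T (a ⊔ b) = T a ⊔ T b) ∧ (∀ a b, T (a ⊓ b) = T a ⊓ T b) ∧
        ∀ x, T (tmul x) = φ x := by
  let f : VectorLatticeTensor E → G :=
    Quotient.lift (s := TensorTerm.setoid E) (TensorTerm.eval φ) fun s t h => h G hG φ hφ
  refine ⟨{ toFun := f, map_add' := ?_, map_smul' := ?_ }, ⟨?_, ?_, fun _ => rfl⟩, ?_⟩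
  · intro a b
    induction a using ind; induction b using ind; rfl
  · intro c a
    induction a using ind; rfl
  · intro a b
    induction a using ind; induction b using ind; rfl
  · intro a b
    induction a using ind; induction b using ind; rfl
  · rintro T ⟨h₁, h₂, h₃⟩
    ext a
    induction a using ind with | _ s
    change T (mk s) = s.eval φ
    induction s with
    | tmul x => exact h₃ x
    | zero => rw [mk_zero, map_zero]; rfl
    | add s t hs ht => rw [mk_add, map_add, hs, ht]; rfl
    | neg s hs => rw [mk_neg, map_neg, hs]; rfl
    | smul c s hs => rw [mk_smul, map_smul, hs]; rfl
    | sup s t hs ht => rw [mk_sup, h₁, hs, ht]; rfl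
    | inf s t hs ht => rw [mk_inf, h₂, hs, ht]; rfl

end Algebra

/-! ### The positive projective tensor norm -/

section Norm

variable {ι : Type} [Fintype ι] {E : ι → Type u}
  [∀ i, NormedAddCommGroup (E i)] [∀ i, NormedSpace ℝ (E i)] [∀ i, Lattice (E i)]

/-- The set of all sums `∑ₖ ‖x₁ₖ‖ ⋯ ‖xₘₖ‖` with `xᵢₖ ≥ 0` and `|u| ≤ ∑ₖ x₁ₖ ⊗ ⋯ ⊗ xₘₖ`. -/
def majorantSums (u : VectorLatticeTensor E) : Set ℝ :=
  {r | ∃ (n : ℕ) (x : Fin n → ∀ i, E i), (∀ k i, 0 ≤ x k i) ∧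
    |u| ≤ ∑ k, tmul (x k) ∧ r = ∑ k, ∏ i, ‖x k i‖}

/-- The positive projective tensor norm `‖u‖_{|π|}`. -/
noncomputable def posProjNorm (u : VectorLatticeTensor E) : ℝ := sInf (majorantSums u)

theorem nonneg_of_mem_majorantSums {u : VectorLatticeTensor E} {r : ℝ}
    (h : r ∈ majorantSums u) : 0 ≤ r := by
  obtain ⟨n, x, -, -, rfl⟩ := h
  positivity

theorem bddBelow_majorantSums (u : VectorLatticeTensor E) : BddBelow (majorantSums u) :=
  ⟨0, fun _ h => nonneg_of_mem_majorantSums h⟩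

theorem zero_mem_majorantSums : 0 ∈ majorantSums (0 : VectorLatticeTensor E) :=
  ⟨0, Fin.elim0, fun k => k.elim0, by simp, by simp⟩

theorem majorantSums_mono {u v : VectorLatticeTensor E} {r : ℝ} (h : |u| ≤ |v|)
    (hr : r ∈ majorantSums v) : r ∈ majorantSums u := by
  obtain ⟨n, x, hx, hv, rfl⟩ := hr
  exact ⟨n, x, hx, h.trans hv, rfl⟩

theorem add_mem_majorantSums {u v w : VectorLatticeTensor E} {r s : ℝ} (hr : r ∈ majorantSums u)
    (hs : s ∈ majorantSums v) (hw : |w| ≤ |u| + |v|) : r + s ∈ majorantSums w := by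
  obtain ⟨n, x, hx, hu, rfl⟩ := hr
  obtain ⟨k, y, hy, hv, rfl⟩ := hs
  refine ⟨n + k, Fin.append x y, ?_, ?_, ?_⟩
  · intro j
    refine Fin.addCases (fun l => ?_) (fun l => ?_) j
    · simpa using hx l
    · simpa using hy l
  · simpa [Fin.sum_univ_add] using hw.trans (add_le_add hu hv)
  · simp [Fin.sum_univ_add]

theorem abs_real_smul_le {X : Type*} [AddCommGroup X] [Module ℝ X] [Lattice X]
    [IsOrderedAddMonoid X] [IsOrderedModule ℝ X] (c : ℝ) (u : X) : |c • u| ≤ |c| • |u| := by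
  rcases le_total 0 c with hc | hc
  · rw [abs_of_nonneg hc]
    refine abs_le'.mpr ⟨smul_le_smul_of_nonneg_left (le_abs_self u) hc, ?_⟩
    rw [← smul_neg]
    exact smul_le_smul_of_nonneg_left (neg_le_abs u) hc
  · rw [abs_of_nonpos hc]
    refine abs_le'.mpr ⟨?_, ?_⟩
    · rw [← neg_smul_neg]
      exact smul_le_smul_of_nonneg_left (neg_le_abs u) (neg_nonneg.mpr hc)
    · rw [← neg_smul]
      exact smul_le_smul_of_nonneg_left (le_abs_self u) (neg_nonneg.mpr hc)

theorem smul_mem_majorantSums [Nonempty ι] [∀ i, IsOrderedModule ℝ (E i)]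
    {u : VectorLatticeTensor E} {r : ℝ} (c : ℝ) (hr : r ∈ majorantSums u) :
    |c| * r ∈ majorantSums (c • u) := by
  classical
  obtain ⟨n, x, hx, hu, rfl⟩ := hr
  obtain ⟨i₀⟩ := ‹Nonempty ι›
  refine ⟨n, fun k => Function.update (x k) i₀ (|c| • x k i₀), ?_, ?_, ?_⟩
  · intro k i
    by_cases h : i = i₀
    · subst h
      simpa using smul_nonneg (abs_nonneg c) (hx k i)
    · simpa [h] using hx k i
  · simp only [MultilinearMap.map_update_smul, Function.update_eq_self, ← Finset.smul_sum]
    exact (abs_real_smul_le c u).trans (smul_le_smul_of_nonneg_left hu (abs_nonneg c))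
  · rw [Finset.mul_sum]
    refine Finset.sum_congr rfl fun k _ => ?_
    rw [← Finset.mul_prod_erase _ _ (Finset.mem_univ i₀),
      ← Finset.mul_prod_erase _ (fun i => ‖Function.update (x k) i₀ (|c| • x k i₀) i‖)
        (Finset.mem_univ i₀), ← mul_assoc]
    congr 1
    · simp [norm_smul]
    · refine Finset.prod_congr rfl fun i hi => ?_
      rw [Function.update_of_ne (Finset.ne_of_mem_erase hi)]

/-- Every element is dominated by a finite sum of positive elementary tensors. -/
theorem majorantSums_nonempty [Nonempty ι] [∀ i, IsOrderedAddMonoid (E i)]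
    [∀ i, IsOrderedModule ℝ (E i)] (u : VectorLatticeTensor E) : (majorantSums u).Nonempty := by
  induction u using ind with | _ s
  induction s with
  | tmul x =>
    refine ⟨_, 1, fun _ i => |x i|, fun _ i => abs_nonneg _, ?_, rfl⟩
    rw [Fin.sum_univ_one]
    exact (isMMorphism_tmul x).le
  | zero => exact ⟨0, zero_mem_majorantSums⟩
  | add s t hs ht =>
    rw [mk_add]
    obtain ⟨r, hr⟩ := hs
    obtain ⟨q, hq⟩ := ht
    exact ⟨r + q, add_mem_majorantSums hr hq (abs_add_le _ _)⟩
  | neg s hs =>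
    rw [mk_neg]
    obtain ⟨r, hr⟩ := hs
    exact ⟨r, majorantSums_mono (abs_neg _).le hr⟩
  | smul c s hs =>
    rw [mk_smul]
    obtain ⟨r, hr⟩ := hs
    exact ⟨|c| * r, smul_mem_majorantSums c hr⟩
  | sup s t hs ht =>
    rw [mk_sup]
    obtain ⟨r, hr⟩ := hs
    obtain ⟨q, hq⟩ := ht
    refine ⟨r + q, add_mem_majorantSums hr hq (abs_le'.mpr ⟨?_, ?_⟩)⟩
    · exact sup_le ((le_abs_self _).trans (le_add_of_nonneg_right (abs_nonneg _)))
        ((le_abs_self _).trans (le_add_of_nonneg_left (abs_nonneg _)))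
    · exact (neg_le_neg le_sup_left).trans
        ((neg_le_abs _).trans (le_add_of_nonneg_right (abs_nonneg _)))
  | inf s t hs ht =>
    rw [mk_inf]
    obtain ⟨r, hr⟩ := hs
    obtain ⟨q, hq⟩ := ht
    refine ⟨r + q, add_mem_majorantSums hr hq (abs_le'.mpr ⟨?_, ?_⟩)⟩
    · exact inf_le_left.trans ((le_abs_self _).trans (le_add_of_nonneg_right (abs_nonneg _)))
    · rw [neg_inf]
      exact sup_le ((neg_le_abs _).trans (le_add_of_nonneg_right (abs_nonneg _)))
        ((neg_le_abs _).trans (le_add_of_nonneg_left (abs_nonneg _)))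

variable [Nonempty ι] [∀ i, IsOrderedAddMonoid (E i)] [∀ i, IsOrderedModule ℝ (E i)]

theorem posProjNorm_add_le (u v : VectorLatticeTensor E) :
    posProjNorm (u + v) ≤ posProjNorm u + posProjNorm v := by
  refine le_of_forall_pos_le_add fun ε hε => ?_
  obtain ⟨r, hr, hr'⟩ := exists_lt_of_csInf_lt (majorantSums_nonempty u)
    (lt_add_of_pos_right (posProjNorm u) (half_pos hε))
  obtain ⟨q, hq, hq'⟩ := exists_lt_of_csInf_lt (majorantSums_nonempty v)
    (lt_add_of_pos_right (posProjNorm v) (half_pos hε))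
  have := csInf_le (bddBelow_majorantSums (u + v)) (add_mem_majorantSums hr hq (abs_add_le u v))
  change posProjNorm (u + v) ≤ _ at this
  linarith

theorem posProjNorm_smul_le (c : ℝ) (u : VectorLatticeTensor E) :
    posProjNorm (c • u) ≤ ‖c‖ * posProjNorm u := by
  refine le_of_forall_pos_le_add fun ε hε => ?_
  obtain ⟨r, hr, hr'⟩ := exists_lt_of_csInf_lt (majorantSums_nonempty u)
    (lt_add_of_pos_right (posProjNorm u) (div_pos hε (by positivity : (0 : ℝ) < |c| + 1)))
  have h := csInf_le (bddBelow_majorantSums (c • u)) (smul_mem_majorantSums c hr)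
  change posProjNorm (c • u) ≤ _ at h
  rw [Real.norm_eq_abs]
  have h1 : |c| * r ≤ |c| * (posProjNorm u + ε / (|c| + 1)) :=
    mul_le_mul_of_nonneg_left hr'.le (abs_nonneg c)
  have h2 : |c| * (ε / (|c| + 1)) ≤ ε := by
    rw [mul_div_assoc', div_le_iff₀ (by positivity)]
    nlinarith [abs_nonneg c]
  linarith [mul_add |c| (posProjNorm u) (ε / (|c| + 1))]

/-- `‖·‖_{|π|}` as a seminorm. -/
noncomputable def posProjSeminorm : Seminorm ℝ (VectorLatticeTensor E) :=
  Seminorm.ofSMulLE posProjNorm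
    (le_antisymm (csInf_le (bddBelow_majorantSums 0) zero_mem_majorantSums)
      (Real.sInf_nonneg fun _ h => nonneg_of_mem_majorantSums h))
    posProjNorm_add_le posProjNorm_smul_le

noncomputable instance : SeminormedAddCommGroup (VectorLatticeTensor E) :=
  posProjSeminorm.toAddGroupSeminorm.toSeminormedAddCommGroup

theorem norm_def (u : VectorLatticeTensor E) : ‖u‖ = sInf (majorantSums u) := rfl

noncomputable instance : NormedSpace ℝ (VectorLatticeTensor E) where
  norm_smul_le := posProjNorm_smul_le

theorem norm_le_norm_of_abs_le {u v : VectorLatticeTensor E} (h : |u| ≤ |v|) : ‖u‖ ≤ ‖v‖ :=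
  csInf_le_csInf (bddBelow_majorantSums u) (majorantSums_nonempty v)
    fun _ hr => majorantSums_mono h hr

end Norm

end VectorLatticeTensor

/-! ### The completion as a Banach lattice -/

/-- The positive projective tensor product `E₁ ⊗̂_{|π|} ⋯ ⊗̂_{|π|} Eₘ` of Banach lattices: the
completion of `(E₁ ⊗̄ ⋯ ⊗̄ Eₘ, ‖·‖_{|π|})`. -/
abbrev PositiveProjectiveTensor {ι : Type} [Fintype ι] [Nonempty ι] (E : ι → Type u)
    [∀ i, NormedAddCommGroup (E i)] [∀ i, NormedSpace ℝ (E i)] [∀ i, Lattice (E i)]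
    [∀ i, IsOrderedAddMonoid (E i)] [∀ i, IsOrderedModule ℝ (E i)] : Type u :=
  UniformSpace.Completion (VectorLatticeTensor E)

namespace PositiveProjectiveTensor

open UniformSpace

variable {ι : Type} [Fintype ι] [Nonempty ι] {E : ι → Type u}
  [∀ i, NormedAddCommGroup (E i)] [∀ i, NormedSpace ℝ (E i)] [∀ i, Lattice (E i)]
  [∀ i, IsOrderedAddMonoid (E i)] [∀ i, IsOrderedModule ℝ (E i)]

theorem norm_abs (u : VectorLatticeTensor E) : ‖|u|‖ = ‖u‖ :=
  le_antisymm (VectorLatticeTensor.norm_le_norm_of_abs_le (abs_abs u).le)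
    (VectorLatticeTensor.norm_le_norm_of_abs_le (abs_abs u).ge)

theorem norm_le_add {u v w : VectorLatticeTensor E} (h : |u| ≤ |v| + |w|) :
    ‖u‖ ≤ ‖v‖ + ‖w‖ := by
  rw [← norm_abs v, ← norm_abs w]
  refine le_trans (VectorLatticeTensor.norm_le_norm_of_abs_le ?_) (norm_add_le _ _)
  rwa [abs_of_nonneg (add_nonneg (abs_nonneg v) (abs_nonneg w))]

theorem uniformContinuous₂_of_abs_sub_le {f : VectorLatticeTensor E → VectorLatticeTensor E →
    VectorLatticeTensor E} (hf : ∀ a b c d, |f a b - f c d| ≤ |a - c| + |b - d|) :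
    UniformContinuous₂ f := by
  refine Metric.uniformContinuous_iff.mpr fun ε hε => ⟨ε / 2, half_pos hε, ?_⟩
  rintro ⟨a, b⟩ ⟨c, d⟩ h
  rw [Prod.dist_eq, max_lt_iff, dist_eq_norm, dist_eq_norm] at h
  have h' := norm_le_add (hf a b c d)
  change dist (f a b) (f c d) < ε
  rw [dist_eq_norm]
  linarith [h.1, h.2]

theorem uniformContinuous₂_sup :
    UniformContinuous₂ ((· ⊔ ·) : VectorLatticeTensor E → VectorLatticeTensor E → _) := by
  refine uniformContinuous₂_of_abs_sub_le fun a b c d => ?_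
  calc |a ⊔ b - c ⊔ d| = |a ⊔ b - c ⊔ b + (c ⊔ b - c ⊔ d)| := by rw [sub_add_sub_cancel]
    _ ≤ |a ⊔ b - c ⊔ b| + |c ⊔ b - c ⊔ d| := abs_add_le _ _
    _ ≤ |a - c| + |b - d| := by
      refine add_le_add (abs_sup_sub_sup_le_abs _ _ _) ?_
      rw [sup_comm c, sup_comm c]
      exact abs_sup_sub_sup_le_abs _ _ _

theorem uniformContinuous₂_inf :
    UniformContinuous₂ ((· ⊓ ·) : VectorLatticeTensor E → VectorLatticeTensor E → _) := by
  refine uniformContinuous₂_of_abs_sub_le fun a b c d => ?_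
  calc |a ⊓ b - c ⊓ d| = |a ⊓ b - c ⊓ b + (c ⊓ b - c ⊓ d)| := by rw [sub_add_sub_cancel]
    _ ≤ |a ⊓ b - c ⊓ b| + |c ⊓ b - c ⊓ d| := abs_add_le _ _
    _ ≤ |a - c| + |b - d| := by
      refine add_le_add (abs_inf_sub_inf_le_abs _ _ _) ?_
      rw [inf_comm c, inf_comm c]
      exact abs_inf_sub_inf_le_abs _ _ _

/-- `⊔` on the completion is the continuous extension of `⊔`. -/
noncomputable def supAux : PositiveProjectiveTensor E → PositiveProjectiveTensor E →
    PositiveProjectiveTensor E := Completion.map₂ (· ⊔ ·)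

/-- `⊓` on the completion is the continuous extension of `⊓`. -/
noncomputable def infAux : PositiveProjectiveTensor E → PositiveProjectiveTensor E →
    PositiveProjectiveTensor E := Completion.map₂ (· ⊓ ·)

theorem coe_supAux (a b : VectorLatticeTensor E) :
    ((a ⊔ b : VectorLatticeTensor E) : PositiveProjectiveTensor E) =
      supAux (a : PositiveProjectiveTensor E) b :=
  (Completion.map₂_coe_coe a b _ uniformContinuous₂_sup).symm

theorem coe_infAux (a b : VectorLatticeTensor E) :
    ((a ⊓ b : VectorLatticeTensor E) : PositiveProjectiveTensor E) =
      infAux (a : PositiveProjectiveTensor E) b :=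
  (Completion.map₂_coe_coe a b _ uniformContinuous₂_inf).symm

theorem continuous_supAux {α : Type*} [TopologicalSpace α] {f g : α → PositiveProjectiveTensor E}
    (hf : Continuous f) (hg : Continuous g) : Continuous fun x => supAux (f x) (g x) :=
  Completion.continuous_map₂ hf hg

theorem continuous_infAux {α : Type*} [TopologicalSpace α] {f g : α → PositiveProjectiveTensor E}
    (hf : Continuous f) (hg : Continuous g) : Continuous fun x => infAux (f x) (g x) :=
  Completion.continuous_map₂ hf hg

/-- In the resulting order, `a ≤ b` iff `a ⊔ b = b`. -/
noncomputable instance : Lattice (PositiveProjectiveTensor E) :=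
  @Lattice.mk' _ ⟨supAux⟩ ⟨infAux⟩
    (fun a b => Completion.induction_on₂ a b
      (isClosed_eq (continuous_supAux continuous_fst continuous_snd)
        (continuous_supAux continuous_snd continuous_fst))
      fun a b => by
        change supAux (a : PositiveProjectiveTensor E) b = supAux (b : PositiveProjectiveTensor E) a
        rw [← coe_supAux, ← coe_supAux, sup_comm])
    (fun a b c => Completion.induction_on₃ a b c
      (isClosed_eq
        (continuous_supAux (continuous_supAux continuous_fst (continuous_fst.comp continuous_snd))
          (continuous_snd.comp continuous_snd))
        (continuous_supAux continuous_fst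
          (continuous_supAux (continuous_fst.comp continuous_snd)
            (continuous_snd.comp continuous_snd))))
      fun a b c => by simp only [← coe_supAux, sup_assoc])
    (fun a b => Completion.induction_on₂ a b
      (isClosed_eq (continuous_infAux continuous_fst continuous_snd)
        (continuous_infAux continuous_snd continuous_fst))
      fun a b => by
        change infAux (a : PositiveProjectiveTensor E) b = infAux (b : PositiveProjectiveTensor E) a
        rw [← coe_infAux, ← coe_infAux, inf_comm])
    (fun a b c => Completion.induction_on₃ a b c
      (isClosed_eq
        (continuous_infAux (continuous_infAux continuous_fst (continuous_fst.comp continuous_snd))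
          (continuous_snd.comp continuous_snd))
        (continuous_infAux continuous_fst
          (continuous_infAux (continuous_fst.comp continuous_snd)
            (continuous_snd.comp continuous_snd))))
      fun a b c => by simp only [← coe_infAux, inf_assoc])
    (fun a b => Completion.induction_on₂ a b
      (isClosed_eq (continuous_supAux continuous_fst (continuous_infAux continuous_fst continuous_snd))
        continuous_fst)
      fun a b => by
        change supAux (a : PositiveProjectiveTensor E) (infAux (a : PositiveProjectiveTensor E) b) = a
        rw [← coe_infAux, ← coe_supAux, sup_inf_self])
    (fun a b => Completion.induction_on₂ a b
      (isClosed_eq (continuous_infAux continuous_fst (continuous_supAux continuous_fst continuous_snd))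
        continuous_fst)
      fun a b => by
        change infAux (a : PositiveProjectiveTensor E) (supAux (a : PositiveProjectiveTensor E) b) = a
        rw [← coe_supAux, ← coe_infAux, inf_sup_self])

theorem coe_sup (a b : VectorLatticeTensor E) :
    ((a ⊔ b : VectorLatticeTensor E) : PositiveProjectiveTensor E) =
      (a : PositiveProjectiveTensor E) ⊔ (b : PositiveProjectiveTensor E) :=
  coe_supAux a b

theorem coe_inf (a b : VectorLatticeTensor E) :
    ((a ⊓ b : VectorLatticeTensor E) : PositiveProjectiveTensor E) =
      (a : PositiveProjectiveTensor E) ⊓ (b : PositiveProjectiveTensor E) :=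
  coe_infAux a b

theorem continuous_sup {α : Type*} [TopologicalSpace α] {f g : α → PositiveProjectiveTensor E}
    (hf : Continuous f) (hg : Continuous g) : Continuous fun x => f x ⊔ g x :=
  continuous_supAux hf hg

theorem continuous_inf {α : Type*} [TopologicalSpace α] {f g : α → PositiveProjectiveTensor E}
    (hf : Continuous f) (hg : Continuous g) : Continuous fun x => f x ⊓ g x :=
  continuous_infAux hf hg

theorem sup_add_sup_add (a b c : PositiveProjectiveTensor E) : (a ⊔ b) + c = (a + c) ⊔ (b + c) :=
  Completion.induction_on₃ a b c
    (isClosed_eq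
      ((continuous_sup continuous_fst (continuous_fst.comp continuous_snd)).add
        (continuous_snd.comp continuous_snd))
      (continuous_sup (continuous_fst.add (continuous_snd.comp continuous_snd))
        ((continuous_fst.comp continuous_snd).add (continuous_snd.comp continuous_snd))))
    fun a b c => by
      simp only [← coe_sup, ← Completion.coe_add]
      rw [sup_add]

noncomputable instance : IsOrderedAddMonoid (PositiveProjectiveTensor E) where
  add_le_add_left a b h c := by
    rw [← sup_eq_right] at h ⊢
    rw [← sup_add_sup_add, h]

noncomputable instance : IsOrderedModule ℝ (PositiveProjectiveTensor E) :=
  .of_smul_nonneg (fun c hc a ha => by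
    have key : ∀ a : PositiveProjectiveTensor E, 0 ⊔ c • (0 ⊔ a) = c • (0 ⊔ a) := fun a =>
      Completion.induction_on a
        (isClosed_eq
          (continuous_sup continuous_const
            ((continuous_sup continuous_const continuous_id).const_smul c))
          ((continuous_sup continuous_const continuous_id).const_smul c))
        fun a => by
          rw [← Completion.coe_zero, ← coe_sup, ← Completion.coe_smul, ← coe_sup,
            sup_eq_right.mpr (smul_nonneg hc le_sup_left)]
    have := key a
    rwa [sup_eq_right.mpr ha, sup_eq_right] at this)

theorem norm_sup_neg (a : PositiveProjectiveTensor E) : ‖a ⊔ -a‖ = ‖a‖ :=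
  Completion.induction_on a
    (isClosed_eq (continuous_sup continuous_id continuous_neg).norm continuous_norm)
    fun a => by
      rw [← Completion.coe_neg, ← coe_sup, Completion.norm_coe, Completion.norm_coe]
      exact norm_abs a

theorem norm_inf_abs_le (a b : PositiveProjectiveTensor E) : ‖(a ⊔ -a) ⊓ (b ⊔ -b)‖ ≤ ‖b‖ :=
  Completion.induction_on₂ a b
    (isClosed_le
      (continuous_inf (continuous_sup continuous_fst continuous_fst.neg)
        (continuous_sup continuous_snd continuous_snd.neg)).norm
      continuous_snd.norm)
    fun a b => by
      simp only [← Completion.coe_neg, ← coe_sup, ← coe_inf, Completion.norm_coe]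
      refine VectorLatticeTensor.norm_le_norm_of_abs_le ?_
      change |(|a| ⊓ |b|)| ≤ |b|
      rw [abs_of_nonneg (le_inf (abs_nonneg a) (abs_nonneg b))]
      exact inf_le_right

instance : HasSolidNorm (PositiveProjectiveTensor E) where
  solid a b h := by
    have h' : (a ⊔ -a) ⊓ (b ⊔ -b) = a ⊔ -a := inf_eq_left.mpr h
    rw [← norm_sup_neg a, ← h']
    exact norm_inf_abs_le a b

end PositiveProjectiveTensor

/-! From the factors to the product: the norm is defined through sums of positive elementary
tensors, so a positive functional is normed, up to a factor 2, by one elementary tensor of positive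
vectors in the unit balls (`exists_half_norm_le`). It therefore suffices that weakly null positive
multilinear forms tend to 0 along such vectors `x n`. This goes by induction on the number of
variables (`tendsto_apply_of_weaklyNull`): freezing all variables but the first gives positive
functionals on `E 0`, and the PSP of the dual of `E 0` reduces the claim to their weak nullity.
Testing them against a positive bidual element amounts to letting that element act on the first
variable, which leaves weakly null positive forms in one variable fewer.

From the product to a factor: tensor the given sequence with fixed nonzero positive functionals on
the other factors. Existence of such positive tensor functionals (`exists_linearMap_tmul_eq_prod`)
is the main construction, because the universal property only concerns m-morphisms. On any finite
set a positive functional is a finite sum of positive functionals respecting moduli there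
(`exists_decomposition`). An ultralimit over finite sets turns the products of these pieces into an
m-morphism modulo the null ideal of a positive functional, and that quotient is Archimedean.

Weak nullity of the tensor functionals is obtained without uniqueness or linearity of the extension,
by a separation argument (`not_frequently_le_of_weaklyNull`). -/

/-- A form of the Hahn–Banach theorem: a convex cone in `X × ℝ` that projects onto `X` and whose
fibre over `0` is nonnegative lies above the graph of a linear functional. -/
theorem exists_linearMap_le_of_convexCone {X : Type*} [AddCommGroup X] [Module ℝ X]
    (S : ConvexCone ℝ (X × ℝ)) (hS : S.Pointed) (h0 : ∀ t, ((0 : X), t) ∈ S → 0 ≤ t)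
    (h1 : ∀ x, ∃ t, (x, t) ∈ S) : ∃ η : X →ₗ[ℝ] ℝ, ∀ x t, (x, t) ∈ S → η x ≤ t := by
  -- M. Riesz extension of the second coordinate from `{0} × ℝ`. Since `0 ≤ g (x, t) = g (x, 0) + t`
  -- on the cone, `η x = -g (x, 0)` works.
  obtain ⟨g, hg, hgS⟩ := riesz_extension (S.toPointedCone hS)
    ⟨Submodule.prod ⊥ ⊤, (LinearMap.snd ℝ X ℝ).domRestrict _⟩
    (by
      rintro ⟨⟨x, t⟩, hx⟩ h
      obtain rfl : x = 0 := by simpa using hx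
      exact h0 t h)
    (by
      rintro ⟨x, t⟩
      obtain ⟨s, hs⟩ := h1 x
      exact ⟨⟨(0, s - t), by simp⟩, by simpa using hs⟩)
  refine ⟨-(g ∘ₗ LinearMap.inl ℝ X ℝ), fun x t h => ?_⟩
  have h2 : g (0, t) = t := hg ⟨(0, t), by simp⟩
  have h3 : g (x, t) = g (x, 0) + g (0, t) := by rw [← map_add]; simp
  have h4 := hgS _ h
  simp only [LinearMap.neg_apply, LinearMap.comp_apply, LinearMap.inl_apply]
  linarith

/-! ### Splitting positive functionals along finitely many elements -/

section Decomposition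

variable {X : Type*} [AddCommGroup X] [Module ℝ X] [Lattice X] [IsOrderedAddMonoid X]
  [IsOrderedModule ℝ X]

omit [IsOrderedAddMonoid X] in
theorem posPart_real_smul {c : ℝ} (hc : 0 < c) (x : X) : (c • x)⁺ = c • x⁺ := by
  refine le_antisymm (sup_le (smul_le_smul_of_nonneg_left le_sup_left hc.le)
    (smul_nonneg hc.le (posPart_nonneg x))) ?_
  rw [← le_inv_smul_iff_of_pos hc]
  refine sup_le ?_ (smul_nonneg (inv_nonneg.mpr hc.le) (posPart_nonneg _))
  rw [le_inv_smul_iff_of_pos hc]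
  exact le_sup_left

omit [Module ℝ X] [IsOrderedModule ℝ X] in
theorem posPart_add_le (x y : X) : (x + y)⁺ ≤ x⁺ + y⁺ :=
  sup_le (add_le_add le_sup_left le_sup_left) (add_nonneg (posPart_nonneg x) (posPart_nonneg y))

omit [IsOrderedModule ℝ X] in
theorem map_le_map_of_nonneg {h : X →ₗ[ℝ] ℝ} (hh : ∀ x, 0 ≤ x → 0 ≤ h x) {x y : X}
    (hxy : x ≤ y) : h x ≤ h y := by
  have := hh _ (sub_nonneg.mpr hxy)
  rw [map_sub] at this
  linarith

omit [IsOrderedModule ℝ X] in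
theorem abs_map_le_map_abs {h : X →ₗ[ℝ] ℝ} (hh : ∀ x, 0 ≤ x → 0 ≤ h x) (x : X) :
    |h x| ≤ h |x| := by
  refine abs_le'.mpr ⟨map_le_map_of_nonneg hh (le_abs_self x), ?_⟩
  rw [← map_neg]
  exact map_le_map_of_nonneg hh (neg_le_abs x)

/-- The component of a positive functional carried by the positive part of `y`. -/
theorem exists_component_of_posPart {h : X →ₗ[ℝ] ℝ} (hh : ∀ x, 0 ≤ x → 0 ≤ h x) (y : X) :
    ∃ k : X →ₗ[ℝ] ℝ, (∀ x, 0 ≤ x → 0 ≤ k x) ∧ (∀ x, 0 ≤ x → k x ≤ h x) ∧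
      k y⁻ = 0 ∧ k y⁺ = h y⁺ := by
  -- Points above some value of `a ↦ h (x + a • y)⁺ - a * h y⁺`. The choice `a = 0` gives `0 ≤ k ≤
  -- h`; `a = 1` at `x = -y` gives `h y⁺ ≤ k y`, which forces both equalities.
  let S : ConvexCone ℝ (X × ℝ) :=
    { carrier := {p | ∃ a : ℝ, h (p.1 + a • y)⁺ - a * h y⁺ ≤ p.2}
      smul_mem' := by
        rintro c hc ⟨x, t⟩ ⟨a, ha⟩
        refine ⟨c * a, ?_⟩
        simp only [Prod.smul_fst, Prod.smul_snd, smul_eq_mul] at ha ⊢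
        rw [mul_smul, ← smul_add, posPart_real_smul hc, map_smul, smul_eq_mul]
        nlinarith
      add_mem' := by
        rintro ⟨x, t⟩ ⟨a, ha⟩ ⟨x', t'⟩ ⟨a', ha'⟩
        refine ⟨a + a', ?_⟩
        simp only [Prod.fst_add, Prod.snd_add] at ha ha' ⊢
        have h1 : x + x' + (a + a') • y = (x + a • y) + (x' + a' • y) := by module
        have h2 := map_le_map_of_nonneg hh (posPart_add_le (x + a • y) (x' + a' • y))
        rw [map_add] at h2
        rw [h1]
        linarith }
  obtain ⟨k, hk⟩ := exists_linearMap_le_of_convexCone S ⟨0, by simp⟩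
    (by
      rintro t ⟨a, ha⟩
      simp only [zero_add] at ha
      refine le_trans ?_ ha
      have hy := hh _ (posPart_nonneg y)
      rcases le_or_gt a 0 with h0 | h0
      · nlinarith [hh _ (posPart_nonneg (a • y))]
      · rw [posPart_real_smul h0, map_smul, smul_eq_mul, sub_self])
    (fun x => ⟨h (x + (0 : ℝ) • y)⁺ - 0 * h y⁺, 0, le_rfl⟩)
  have h1 : ∀ x, k x ≤ h x⁺ := fun x => hk x _ ⟨0, by simp⟩
  have h2 : h y⁺ ≤ k y := by
    have := hk (-y) (-h y⁺) ⟨1, by simp⟩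
    rw [map_neg] at this
    linarith
  have hpos : ∀ x, 0 ≤ x → 0 ≤ k x := fun x hx => by
    have := h1 (-x)
    rw [posPart_eq_zero.mpr (neg_nonpos.mpr hx), map_zero, map_neg] at this
    linarith
  have hle : ∀ x, 0 ≤ x → k x ≤ h x := fun x hx => by
    simpa [posPart_eq_self.mpr hx] using h1 x
  have h3 : k y = k y⁺ - k y⁻ := by rw [← map_sub, posPart_sub_negPart]
  have h4 := hle _ (posPart_nonneg y)
  have h5 := hpos _ (negPart_nonneg y)
  exact ⟨k, hpos, hle, by linarith, by linarith⟩

/-- A positive functional is a finite sum of positive functionals that behave like lattice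
homomorphisms on a given finite set. -/
theorem exists_decomposition {f : X →ₗ[ℝ] ℝ} (hf : ∀ x, 0 ≤ x → 0 ≤ f x) (A : Finset X) :
    ∃ (J : Type) (_ : Fintype J) (h : J → X →ₗ[ℝ] ℝ), (∀ j x, 0 ≤ x → 0 ≤ h j x) ∧
      (∀ x, ∑ j, h j x = f x) ∧ ∀ j, ∀ y ∈ A, h j y⁻ = 0 ∨ h j y⁺ = 0 := by
  classical
  induction A using Finset.induction_on with
  | empty => exact ⟨Unit, inferInstance, fun _ => f, fun _ => hf, by simp, by simp⟩
  | insert y A _ ih =>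
    obtain ⟨J, _, h, hh, hs, hA⟩ := ih
    choose k hk hkh hk1 hk2 using fun j => exists_component_of_posPart (hh j) y
    have hk' : ∀ j x, 0 ≤ x → 0 ≤ (h j - k j) x := fun j x hx => sub_nonneg.mpr (hkh j x hx)
    -- Each old piece splits in two: `k j` vanishes at `y⁻`, and `h j - k j` vanishes at `y⁺`.
    refine ⟨J × Bool, inferInstance, fun p => if p.2 then k p.1 else h p.1 - k p.1, ?_, ?_, ?_⟩
    · rintro ⟨j, _ | _⟩ x hx
      · exact hk' j x hx
      · exact hk j x hx
    · intro x
      rw [Fintype.sum_prod_type, ← hs x]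
      simp
    -- Vanishing at a positive element passes to smaller positive functionals, so refining a piece
    -- keeps what was achieved on `A`.
    · have key : ∀ (j : J) (g : X →ₗ[ℝ] ℝ), (∀ x, 0 ≤ x → 0 ≤ g x) → (∀ x, 0 ≤ x → g x ≤ h j x) →
          ∀ z ∈ A, g z⁻ = 0 ∨ g z⁺ = 0 := by
        intro j g hg hgh z hz
        refine (hA j z hz).imp (fun h0 => ?_) (fun h0 => ?_)
        · exact le_antisymm (h0 ▸ hgh _ (negPart_nonneg z)) (hg _ (negPart_nonneg z))
        · exact le_antisymm (h0 ▸ hgh _ (posPart_nonneg z)) (hg _ (posPart_nonneg z))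
      rintro ⟨j, _ | _⟩ z hz
      · rcases Finset.mem_insert.mp hz with rfl | hz
        · right; simp [hk2]
        · exact key j _ (hk' j) (fun x hx => sub_le_self _ (hk j x hx)) z hz
      · rcases Finset.mem_insert.mp hz with rfl | hz
        · left; simp [hk1]
        · exact key j _ (hk j) (hkh j) z hz

omit [IsOrderedModule ℝ X] in
theorem abs_map_eq_map_abs {h : X →ₗ[ℝ] ℝ} (hh : ∀ x, 0 ≤ x → 0 ≤ h x) {y : X}
    (hy : h y⁻ = 0 ∨ h y⁺ = 0) : |h y| = h |y| := by
  have h1 : h y = h y⁺ - h y⁻ := by rw [← map_sub, posPart_sub_negPart]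
  have h2 : h |y| = h y⁺ + h y⁻ := by rw [← map_add, posPart_add_negPart]
  rcases hy with hy | hy
  · rw [h1, h2, hy, sub_zero, add_zero, abs_of_nonneg (hh _ (posPart_nonneg y))]
  · rw [h1, h2, hy, zero_sub, zero_add, abs_neg, abs_of_nonneg (hh _ (negPart_nonneg y))]

end Decomposition

/-! ### The quotient of a vector lattice by the null ideal of a positive functional -/

section NullIdeal

variable {V : Type u} [AddCommGroup V] [Module ℝ V] [Lattice V] [IsOrderedAddMonoid V]
  [IsOrderedModule ℝ V]

/-- The ideal of all `v` with `f |v| = 0`. -/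
def nullIdeal (f : V →ₗ[ℝ] ℝ) (hf : ∀ x, 0 ≤ x → 0 ≤ f x) : Submodule ℝ V where
  carrier := {v | f |v| = 0}
  zero_mem' := by simp
  add_mem' := by
    intro a b ha hb
    refine le_antisymm ?_ (hf _ (abs_nonneg _))
    have := map_le_map_of_nonneg hf (abs_add_le a b)
    rw [map_add] at this
    exact this.trans (by rw [show f |a| = 0 from ha, show f |b| = 0 from hb, add_zero])
  smul_mem' := by
    intro c a ha
    refine le_antisymm ?_ (hf _ (abs_nonneg _))
    have := map_le_map_of_nonneg hf (VectorLatticeTensor.abs_real_smul_le c a)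
    rw [map_smul] at this
    exact this.trans (by rw [show f |a| = 0 from ha, smul_zero])

variable {f : V →ₗ[ℝ] ℝ} {hf : ∀ x, 0 ≤ x → 0 ≤ f x}

theorem mem_nullIdeal {v : V} : v ∈ nullIdeal f hf ↔ f |v| = 0 := Iff.rfl

theorem mem_nullIdeal_of_abs_le {u v : V} (h : |u| ≤ v) (hv : f v = 0) : u ∈ nullIdeal f hf :=
  le_antisymm (hv ▸ map_le_map_of_nonneg hf h) (hf _ (abs_nonneg _))

theorem mem_nullIdeal_of_abs_le_add {u v w : V} (h : |u| ≤ |v| + |w|) (hv : v ∈ nullIdeal f hf)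
    (hw : w ∈ nullIdeal f hf) : u ∈ nullIdeal f hf :=
  mem_nullIdeal_of_abs_le h (by rw [map_add, mem_nullIdeal.mp hv, mem_nullIdeal.mp hw, add_zero])

variable (f hf) in
/-- The quotient of a vector lattice by the null ideal of a positive functional. -/
def NullQuotient : Type u := V ⧸ nullIdeal f hf

namespace NullQuotient

instance : AddCommGroup (NullQuotient f hf) :=
  inferInstanceAs (AddCommGroup (V ⧸ nullIdeal f hf))

instance : Module ℝ (NullQuotient f hf) := inferInstanceAs (Module ℝ (V ⧸ nullIdeal f hf))

variable (f hf) in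
/-- The quotient map. -/
def mk : V →ₗ[ℝ] NullQuotient f hf := (nullIdeal f hf).mkQ

theorem mk_eq_mk {u v : V} : mk f hf u = mk f hf v ↔ u - v ∈ nullIdeal f hf :=
  Submodule.Quotient.eq _

theorem ind {p : NullQuotient f hf → Prop} (h : ∀ v, p (mk f hf v)) (a : NullQuotient f hf) :
    p a := Submodule.Quotient.induction_on _ a h

/-- The null ideal is solid, so an order-Lipschitz operation descends to the quotient; needed for
`⊔` and `⊓`. -/
theorem mk_map₂ {F : V → V → V} (hF : ∀ a b c d, |F a b - F c d| ≤ |a - c| + |b - d|)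
    {a b c d : V} (h : mk f hf a = mk f hf c) (h' : mk f hf b = mk f hf d) :
    mk f hf (F a b) = mk f hf (F c d) := by
  rw [mk_eq_mk] at *
  exact mem_nullIdeal_of_abs_le_add (hF a b c d) h h'

omit [Module ℝ V] [IsOrderedModule ℝ V] in
theorem abs_sup_sub_sup_le_add (a b c d : V) : |a ⊔ b - c ⊔ d| ≤ |a - c| + |b - d| :=
  calc |a ⊔ b - c ⊔ d| = |a ⊔ b - c ⊔ b + (c ⊔ b - c ⊔ d)| := by rw [sub_add_sub_cancel]
    _ ≤ |a ⊔ b - c ⊔ b| + |c ⊔ b - c ⊔ d| := abs_add_le _ _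
    _ ≤ |a - c| + |b - d| := by
      refine add_le_add (abs_sup_sub_sup_le_abs _ _ _) ?_
      rw [sup_comm c, sup_comm c]
      exact abs_sup_sub_sup_le_abs _ _ _

omit [Module ℝ V] [IsOrderedModule ℝ V] in
theorem abs_inf_sub_inf_le_add (a b c d : V) : |a ⊓ b - c ⊓ d| ≤ |a - c| + |b - d| :=
  calc |a ⊓ b - c ⊓ d| = |a ⊓ b - c ⊓ b + (c ⊓ b - c ⊓ d)| := by rw [sub_add_sub_cancel]
    _ ≤ |a ⊓ b - c ⊓ b| + |c ⊓ b - c ⊓ d| := abs_add_le _ _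
    _ ≤ |a - c| + |b - d| := by
      refine add_le_add (abs_inf_sub_inf_le_abs _ _ _) ?_
      rw [inf_comm c, inf_comm c]
      exact abs_inf_sub_inf_le_abs _ _ _

/-- The supremum of two classes. -/
def supAux : NullQuotient f hf → NullQuotient f hf → NullQuotient f hf :=
  Quotient.map₂ (· ⊔ ·) fun a c h b d h' => by
    have h1 : mk f hf a = mk f hf c := Quotient.sound h
    have h2 : mk f hf b = mk f hf d := Quotient.sound h'
    exact Quotient.exact (mk_map₂ abs_sup_sub_sup_le_add h1 h2)

/-- The infimum of two classes. -/
def infAux : NullQuotient f hf → NullQuotient f hf → NullQuotient f hf :=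
  Quotient.map₂ (· ⊓ ·) fun a c h b d h' => by
    have h1 : mk f hf a = mk f hf c := Quotient.sound h
    have h2 : mk f hf b = mk f hf d := Quotient.sound h'
    exact Quotient.exact (mk_map₂ abs_inf_sub_inf_le_add h1 h2)

/-- In the resulting order, `a ≤ b` iff `a ⊔ b = b`. -/
instance : Lattice (NullQuotient f hf) :=
  @Lattice.mk' _ ⟨supAux⟩ ⟨infAux⟩
    (fun a b => by
      induction a using ind; induction b using ind
      exact congrArg (mk f hf) (sup_comm _ _))
    (fun a b c => by
      induction a using ind; induction b using ind; induction c using ind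
      exact congrArg (mk f hf) (sup_assoc _ _ _))
    (fun a b => by
      induction a using ind; induction b using ind
      exact congrArg (mk f hf) (inf_comm _ _))
    (fun a b c => by
      induction a using ind; induction b using ind; induction c using ind
      exact congrArg (mk f hf) (inf_assoc _ _ _))
    (fun a b => by
      induction a using ind; induction b using ind
      exact congrArg (mk f hf) sup_inf_self)
    (fun a b => by
      induction a using ind; induction b using ind
      exact congrArg (mk f hf) inf_sup_self)

theorem mk_sup (a b : V) : mk f hf (a ⊔ b) = mk f hf a ⊔ mk f hf b := rfl

theorem mk_abs (a : V) : mk f hf |a| = |mk f hf a| := rfl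

instance : IsOrderedAddMonoid (NullQuotient f hf) where
  add_le_add_left a b h c := by
    rw [← sup_eq_right] at h ⊢
    induction a using ind with | _ a
    induction b using ind with | _ b
    induction c using ind with | _ c
    rw [← map_add, ← map_add, ← mk_sup, ← sup_add, map_add, mk_sup, h, map_add]

instance : IsOrderedModule ℝ (NullQuotient f hf) :=
  .of_smul_nonneg (fun c hc a ha => by
    rw [← sup_eq_right] at ha
    induction a using ind with | _ a
    rw [← map_zero (mk f hf), ← mk_sup] at ha
    rw [← ha, ← map_smul, ← map_zero (mk f hf), ← sup_eq_right, ← mk_sup,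
      sup_eq_right.mpr (smul_nonneg hc le_sup_left)])

variable (f hf) in
/-- The functional induced on the quotient. -/
def lift : NullQuotient f hf →ₗ[ℝ] ℝ :=
  (nullIdeal f hf).liftQ f fun v hv => by
    have := abs_map_le_map_abs hf v
    rw [mem_nullIdeal.mp hv] at this
    exact abs_nonpos_iff.mp this

theorem lift_mk (v : V) : lift f hf (mk f hf v) = f v := rfl

theorem lift_nonneg (a : NullQuotient f hf) (ha : 0 ≤ a) : 0 ≤ lift f hf a := by
  rw [← sup_eq_right] at ha
  induction a using ind with | _ a
  rw [← ha, ← map_zero (mk f hf), ← mk_sup, lift_mk]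
  exact hf _ le_sup_left

/-- The functional becomes strictly positive on the quotient: if `n u ≤ v` modulo null elements for
all `n`, then `n * f u⁺ ≤ f v⁺` for all `n`, so `u⁺` is null. This makes the quotient an admissible
target for the universal property. -/
theorem isArchimedeanLattice : IsArchimedeanLattice (NullQuotient f hf) := by
  intro a b h
  induction a using ind with | _ u
  induction b using ind with | _ v
  suffices h0 : f u⁺ ≤ 0 by
    rw [← sup_eq_right, ← map_zero (mk f hf), ← mk_sup, mk_eq_mk, sub_zero, mem_nullIdeal,
      abs_of_nonneg le_sup_right]
    exact le_antisymm h0 (hf _ le_sup_right)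
  have key : ∀ n : ℕ, n * f u⁺ ≤ f v⁺ := fun n => by
    have h1 := h n
    rw [← map_nsmul, ← sup_eq_right, ← mk_sup, mk_eq_mk, mem_nullIdeal,
      abs_of_nonneg (sub_nonneg.mpr le_sup_right)] at h1
    -- By `h1`, `f` annihilates the excess `n • u ⊔ v - v`. The case `n = 0` is separate because
    -- `posPart_real_smul` needs a positive scalar.
    have h2 : (n : ℝ) • u⁺ ≤ (n • u ⊔ v - v) + v⁺ := by
      rcases n.eq_zero_or_pos with rfl | hn
      · rw [Nat.cast_zero, zero_smul]
        exact add_nonneg (sub_nonneg.mpr le_sup_right) (posPart_nonneg v)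
      · rw [← posPart_real_smul (by exact_mod_cast hn), Nat.cast_smul_eq_nsmul]
        refine sup_le ?_ (add_nonneg (sub_nonneg.mpr le_sup_right) (posPart_nonneg v))
        calc n • u ≤ n • u ⊔ v - v + v := by rw [sub_add_cancel]; exact le_sup_left
          _ ≤ _ := by gcongr; exact le_sup_left
    have h3 := map_le_map_of_nonneg hf h2
    rw [map_smul, map_add, h1, zero_add] at h3
    exact h3
  by_contra! hpos
  obtain ⟨n, hn⟩ := exists_nat_gt (f v⁺ / f u⁺)
  rw [div_lt_iff₀ hpos] at hn
  exact absurd (key n) (not_le.mpr hn)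

end NullQuotient

/-- A multilinear map that preserves moduli up to null elements of a positive functional `f`
yields a positive functional on the vector lattice tensor product. -/
theorem VectorLatticeTensor.exists_linearMap_of_abs_sub {ι : Type} {E : ι → Type u}
    [∀ i, AddCommGroup (E i)] [∀ i, Module ℝ (E i)] [∀ i, Lattice (E i)]
    (hf : ∀ x, 0 ≤ x → 0 ≤ f x) (φ : MultilinearMap ℝ E V)
    (hφ : ∀ x, f |(|φ x| - φ fun i => |x i|)| = 0) :
    ∃ F : VectorLatticeTensor E →ₗ[ℝ] ℝ, (∀ u, 0 ≤ u → 0 ≤ F u) ∧ ∀ x, F (tmul x) = f (φ x) := by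
  obtain ⟨T, ⟨hT, -, hT'⟩, -⟩ := existsUnique_lift
    (NullQuotient.isArchimedeanLattice (f := f) (hf := hf))
    ((NullQuotient.mk f hf).compMultilinearMap φ) fun x => by
      rw [LinearMap.compMultilinearMap_apply, ← NullQuotient.mk_abs,
        LinearMap.compMultilinearMap_apply, NullQuotient.mk_eq_mk]
      exact hφ x
  refine ⟨NullQuotient.lift f hf ∘ₗ T, fun u hu => ?_, fun x => ?_⟩
  · refine NullQuotient.lift_nonneg _ ?_
    rw [← sup_eq_right] at hu ⊢
    rw [← map_zero T, ← hT, hu]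
  · rw [LinearMap.comp_apply, hT']
    rfl

end NullIdeal

/-! ### Ultralimits of finite sums -/

section FiberSum

variable {α : Type u} (J : α → Type) [∀ a, Fintype (J a)]

/-- Families on `Σ a, J a` whose fibrewise `ℓ¹`-norms are bounded. -/
def fiberBounded : Submodule ℝ ((Σ a, J a) → ℝ) where
  carrier := {v | ∃ C, ∀ a, ∑ j, |v ⟨a, j⟩| ≤ C}
  zero_mem' := ⟨0, by simp⟩
  add_mem' := by
    rintro v w ⟨C, hC⟩ ⟨D, hD⟩
    refine ⟨C + D, fun a => (Finset.sum_le_sum fun j _ => abs_add_le _ _).trans ?_⟩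
    rw [Finset.sum_add_distrib]
    exact add_le_add (hC a) (hD a)
  smul_mem' := by
    rintro c v ⟨C, hC⟩
    refine ⟨|c| * C, fun a => ?_⟩
    simp only [Pi.smul_apply, smul_eq_mul, abs_mul, ← Finset.mul_sum]
    exact mul_le_mul_of_nonneg_left (hC a) (abs_nonneg c)

variable {J}

theorem fiberBounded_of_abs_le {u v w : (Σ a, J a) → ℝ} (h : ∀ p, |u p| ≤ |v p| + |w p|)
    (hv : v ∈ fiberBounded J) (hw : w ∈ fiberBounded J) : u ∈ fiberBounded J := by
  obtain ⟨C, hC⟩ := hv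
  obtain ⟨D, hD⟩ := hw
  refine ⟨C + D, fun a => (Finset.sum_le_sum fun j _ => h _).trans ?_⟩
  rw [Finset.sum_add_distrib]
  exact add_le_add (hC a) (hD a)

noncomputable instance : Lattice (fiberBounded J) :=
  Subtype.lattice
    (fun {_ _} hv hw => fiberBounded_of_abs_le (fun _ => abs_max_le_max_abs_abs.trans
      (max_le_add_of_nonneg (abs_nonneg _) (abs_nonneg _))) hv hw)
    (fun {v w} hv hw => fiberBounded_of_abs_le (fun p => by
      rw [Pi.inf_apply]
      rcases min_choice (v p) (w p) with h | h <;> rw [h]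
      · exact le_add_of_nonneg_right (abs_nonneg _)
      · exact le_add_of_nonneg_left (abs_nonneg _)) hv hw)

instance : IsOrderedModule ℝ (fiberBounded J) :=
  IsOrderedModule.of_smul_nonneg (β := fiberBounded J)
    fun _ hc v (hv : ∀ p, 0 ≤ v.1 p) p => mul_nonneg hc (hv p)

/-- The fibre sums stay in a compact interval, where every ultrafilter converges. -/
theorem exists_tendsto_fiberSum (U : Ultrafilter α) (v : fiberBounded J) :
    ∃ L, Tendsto (fun a => ∑ j, v.1 ⟨a, j⟩) U (𝓝 L) := by
  obtain ⟨C, hC⟩ := v.2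
  obtain ⟨L, -, hL⟩ := (isCompact_Icc (a := -C) (b := C)).ultrafilter_le_nhds
    (U.map fun a => ∑ j, v.1 ⟨a, j⟩) (by
      rw [Filter.le_principal_iff, Ultrafilter.mem_coe, Ultrafilter.mem_map]
      exact Filter.mem_of_superset Filter.univ_mem fun a _ =>
        abs_le.mp ((Finset.abs_sum_le_sum_abs _ _).trans (hC a)))
  exact ⟨L, hL⟩

/-- The limit of the fibrewise sums along an ultrafilter. -/
noncomputable def fiberLimit (U : Ultrafilter α) : fiberBounded J →ₗ[ℝ] ℝ where
  toFun v := (exists_tendsto_fiberSum U v).choose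
  map_add' v w := by
    refine tendsto_nhds_unique (exists_tendsto_fiberSum U (v + w)).choose_spec ?_
    simpa [Finset.sum_add_distrib] using (exists_tendsto_fiberSum U v).choose_spec.add
      (exists_tendsto_fiberSum U w).choose_spec
  map_smul' c v := by
    refine tendsto_nhds_unique (exists_tendsto_fiberSum U (c • v)).choose_spec ?_
    simpa [Finset.mul_sum] using (exists_tendsto_fiberSum U v).choose_spec.const_mul c

theorem fiberLimit_eq {U : Ultrafilter α} {v : fiberBounded J} {L : ℝ}
    (h : ∀ᶠ a in U, ∑ j, v.1 ⟨a, j⟩ = L) : fiberLimit U v = L :=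
  tendsto_nhds_unique (exists_tendsto_fiberSum U v).choose_spec
    (tendsto_const_nhds.congr' (h.mono fun _ h => h.symm))

theorem fiberLimit_nonneg {U : Ultrafilter α} (v : fiberBounded J) (hv : 0 ≤ v) :
    0 ≤ fiberLimit U v :=
  ge_of_tendsto' (exists_tendsto_fiberSum U v).choose_spec fun _ =>
    Finset.sum_nonneg fun _ _ => hv _

end FiberSum

/-- Positive functionals `f₁, …, fₘ` have a positive tensor product on the vector lattice tensor
product. -/
theorem VectorLatticeTensor.exists_linearMap_tmul_eq_prod {ι : Type} [Fintype ι] {E : ι → Type u}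
    [∀ i, AddCommGroup (E i)] [∀ i, Module ℝ (E i)] [∀ i, Lattice (E i)]
    [∀ i, IsOrderedAddMonoid (E i)] [∀ i, IsOrderedModule ℝ (E i)]
    (f : ∀ i, E i →ₗ[ℝ] ℝ) (hf : ∀ i x, 0 ≤ x → 0 ≤ f i x) :
    ∃ F : VectorLatticeTensor E →ₗ[ℝ] ℝ, (∀ u, 0 ≤ u → 0 ≤ F u) ∧
      ∀ x, F (tmul x) = ∏ i, f i (x i) := by
  classical
  choose K hK h h0 hsum hA using fun i => exists_decomposition (hf i)
  -- One finite set per factor, directed by inclusion; `J A` lists the ways to pick one piece of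
  -- each `f i`.
  let α := ∀ i, Finset (E i)
  let J : α → Type := fun A => ∀ i, K i (A i)
  let ψ : ∀ p : (Σ A, J A), MultilinearMap ℝ E ℝ := fun p =>
    (MultilinearMap.mkPiAlgebra ℝ ι ℝ).compLinearMap fun i => h i (p.1 i) (p.2 i)
  have hψ : ∀ p x, ψ p x = ∏ i, h i (p.1 i) (p.2 i) (x i) := fun p x => rfl
  -- Multiplying out the sums gives the same total for every `A`; this bounds `Φ` and later makes
  -- the ultralimit constant.
  have hψsum : ∀ A x, ∑ j : J A, ψ ⟨A, j⟩ x = ∏ i, f i (x i) := fun A x => by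
    simp only [hψ, ← hsum _ (A _)]
    exact (Finset.prod_univ_sum (fun _ => Finset.univ) fun i k => h i (A i) k (x i)).symm
  have hψabs : ∀ p x, |ψ p x| ≤ ψ p fun i => |x i| := fun p x => by
    rw [hψ, hψ, Finset.abs_prod]
    exact Finset.prod_le_prod (fun _ _ => abs_nonneg _) fun i _ => abs_map_le_map_abs (h0 i _ _) _
  let Φ : MultilinearMap ℝ E (fiberBounded J) :=
    { toFun := fun x => ⟨fun p => ψ p x, ∏ i, f i |x i|, fun A => by
        rw [← hψsum A]
        exact Finset.sum_le_sum fun j _ => hψabs _ _⟩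
      map_update_add' := fun x i a b => Subtype.ext <| funext fun p => by
        convert (ψ p).map_update_add x i a b
        rfl
      map_update_smul' := fun x i c a => Subtype.ext <| funext fun p => by
        convert (ψ p).map_update_smul x i c a
        rfl }
  let U : Ultrafilter α := Ultrafilter.of atTop
  have hΦ : ∀ x, fiberLimit U |(|Φ x| - Φ fun i => |x i|)| = 0 := fun x => by
    refine fiberLimit_eq (Ultrafilter.of_le _ ?_)
    -- Once `A` contains every `x i`, each piece respects the modulus of `x i`, so the fibre sum
    -- vanishes.
    filter_upwards [eventually_ge_atTop fun i => {x i}] with A hxA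
    refine Finset.sum_eq_zero fun j _ => ?_
    have h1 : |ψ ⟨A, j⟩ x| = ψ ⟨A, j⟩ fun i => |x i| := by
      rw [hψ, hψ, Finset.abs_prod]
      exact Finset.prod_congr rfl fun i _ => abs_map_eq_map_abs (h0 i _ _)
        (hA i _ _ _ (Finset.singleton_subset_iff.mp (hxA i)))
    change |(|ψ ⟨A, j⟩ x| - ψ ⟨A, j⟩ fun i => |x i|)| = 0
    rw [h1, sub_self, abs_zero]
  obtain ⟨F, hF, hF'⟩ := exists_linearMap_of_abs_sub (f := fiberLimit U) fiberLimit_nonneg Φ hΦ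
  exact ⟨F, hF, fun x => (hF' x).trans (fiberLimit_eq (Eventually.of_forall fun A => hψsum A x))⟩

/-! ### Positive functionals on ordered normed spaces -/

section PositiveFunctionals

/-- In an ordered normed space with monotone norm, in which every `x` has a positive upper bound
of norm at most `‖x‖`, every continuous functional is dominated by a positive one. -/
theorem exists_nonneg_strongDual_ge {X : Type*} [NormedAddCommGroup X] [NormedSpace ℝ X]
    [PartialOrder X] [IsOrderedAddMonoid X] [IsOrderedModule ℝ X]
    (hmono : ∀ x y : X, 0 ≤ x → x ≤ y → ‖x‖ ≤ ‖y‖)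
    (hgen : ∀ x : X, ∃ y, 0 ≤ y ∧ x ≤ y ∧ ‖y‖ ≤ ‖x‖) (ξ : StrongDual ℝ X) :
    ∃ η : StrongDual ℝ X, (∀ x, 0 ≤ x → 0 ≤ η x) ∧ (∀ x, 0 ≤ x → ξ x ≤ η x) ∧ ‖η‖ ≤ ‖ξ‖ := by
  -- The cone encodes all constraints on `η` at once: `z = 0` yields the norm bound, `y = z = 0`
  -- positivity, and `y = 0`, `z = x` domination of `ξ`. They are compatible because `0 ≤ z ≤ y`
  -- gives `ξ z ≤ ‖ξ‖ * ‖y‖`.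
  let S : ConvexCone ℝ (X × ℝ) :=
    { carrier := {p | ∃ y z : X, 0 ≤ y ∧ 0 ≤ z ∧ p.1 + z ≤ y ∧ ‖ξ‖ * ‖y‖ - ξ z ≤ p.2}
      smul_mem' := by
        rintro c hc ⟨x, t⟩ ⟨y, z, hy, hz, h1, h2⟩
        refine ⟨c • y, c • z, smul_nonneg hc.le hy, smul_nonneg hc.le hz, ?_, ?_⟩
        · simpa using smul_le_smul_of_nonneg_left h1 hc.le
        · simp only [Prod.smul_snd, smul_eq_mul, map_smul, norm_smul, Real.norm_of_nonneg hc.le]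
            at h2 ⊢
          nlinarith
      add_mem' := by
        rintro ⟨x, t⟩ ⟨y, z, hy, hz, h1, h2⟩ ⟨x', t'⟩ ⟨y', z', hy', hz', h1', h2'⟩
        refine ⟨y + y', z + z', add_nonneg hy hy', add_nonneg hz hz', ?_, ?_⟩
        · simpa [add_add_add_comm] using add_le_add h1 h1'
        · simp only [Prod.snd_add, map_add] at h2 h2' ⊢
          nlinarith [norm_add_le y y', norm_nonneg ξ] }
  obtain ⟨η, hη⟩ := exists_linearMap_le_of_convexCone S ⟨0, 0, by simp⟩
    (by
      rintro t ⟨y, z, hy, hz, h1, h2⟩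
      simp only [zero_add] at h1 h2
      have h3 := (le_abs_self _).trans (ξ.le_opNorm z)
      have h4 := mul_le_mul_of_nonneg_left (hmono z y hz h1) (norm_nonneg ξ)
      linarith)
    (fun x => by
      obtain ⟨y, hy, hxy, -⟩ := hgen x
      exact ⟨‖ξ‖ * ‖y‖, y, 0, hy, le_rfl, by simpa using hxy, by simp⟩)
  have hbound : ∀ x, η x ≤ ‖ξ‖ * ‖x‖ := fun x => by
    obtain ⟨y, hy, hxy, hn⟩ := hgen x
    refine (hη x (‖ξ‖ * ‖y‖) ⟨y, 0, hy, le_rfl, by simpa using hxy, by simp⟩).trans ?_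
    exact mul_le_mul_of_nonneg_left hn (norm_nonneg _)
  refine ⟨η.mkContinuous ‖ξ‖ fun x => ?_, fun x hx => ?_, fun x hx => ?_,
    η.mkContinuous_norm_le (norm_nonneg _) _⟩
  · refine abs_le'.mpr ⟨hbound x, ?_⟩
    rw [← map_neg, ← norm_neg x]
    exact hbound _
  · have := hη (-x) 0 ⟨0, 0, le_rfl, le_rfl, by simpa using hx, by simp⟩
    rw [map_neg] at this
    exact neg_nonpos.mp this
  · have := hη (-x) (-ξ x) ⟨0, x, le_rfl, hx, by simp, by simp⟩
    rw [map_neg] at this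
    exact neg_le_neg_iff.mp this

section BanachLattice

variable {X : Type*} [NormedAddCommGroup X] [NormedSpace ℝ X] [Lattice X] [IsOrderedAddMonoid X]

instance : IsOrderedAddMonoid (StrongDual ℝ X) where
  add_le_add_left _ _ h c x hx := add_le_add_left (h x hx) (c x)

instance : IsOrderedModule ℝ (StrongDual ℝ X) :=
  IsOrderedModule.of_smul_nonneg (β := StrongDual ℝ X)
    fun _ hc f (hf : ∀ x, 0 ≤ x → 0 ≤ f x) x hx => mul_nonneg hc (hf x hx)

variable [HasSolidNorm X]

omit [NormedSpace ℝ X] in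
theorem norm_le_norm_of_nonneg_of_le {x y : X} (hx : 0 ≤ x) (hxy : x ≤ y) : ‖x‖ ≤ ‖y‖ :=
  HasSolidNorm.solid (by rwa [abs_of_nonneg hx, abs_of_nonneg (hx.trans hxy)])

variable [IsOrderedModule ℝ X]

/-- Besides its direct use, this supplies the hypothesis `hgen` for the dual itself, so
`exists_nonneg_strongDual_ge` also applies to bidual elements with no lattice structure on the dual.
-/
theorem StrongDual.exists_nonneg_ge (ξ : StrongDual ℝ X) :
    ∃ η : StrongDual ℝ X, 0 ≤ η ∧ ξ ≤ η ∧ ‖η‖ ≤ ‖ξ‖ :=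
  exists_nonneg_strongDual_ge (fun _ _ => norm_le_norm_of_nonneg_of_le)
    (fun x => ⟨|x|, abs_nonneg x, le_abs_self x, (norm_abs_eq_norm x).le⟩) ξ

omit [IsOrderedModule ℝ X] in
theorem StrongDual.norm_le_norm_of_nonneg_of_le {f g : StrongDual ℝ X} (hf : 0 ≤ f)
    (hfg : f ≤ g) : ‖f‖ ≤ ‖g‖ :=
  f.opNorm_le_bound (norm_nonneg _) fun x =>
    calc ‖f x‖ ≤ f |x| := abs_map_le_map_abs (h := f.toLinearMap) hf x
      _ ≤ g |x| := hfg _ (abs_nonneg x)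
      _ ≤ ‖g‖ * ‖|x|‖ := (le_abs_self _).trans (g.le_opNorm _)
      _ = ‖g‖ * ‖x‖ := by rw [norm_abs_eq_norm]

/-- A sequence in the dual of a Banach lattice is weakly null if it is annihilated in the limit by
the positive functionals. -/
theorem StrongDual.tendsto_of_forall_nonneg {f : ℕ → StrongDual ℝ X}
    (h : ∀ ξ : StrongDual ℝ (StrongDual ℝ X), (∀ g, 0 ≤ g → 0 ≤ ξ g) →
      Tendsto (fun n => ξ (f n)) atTop (𝓝 0)) (ξ : StrongDual ℝ (StrongDual ℝ X)) :
    Tendsto (fun n => ξ (f n)) atTop (𝓝 0) := by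
  obtain ⟨η, h0, h1, -⟩ := exists_nonneg_strongDual_ge
    (fun _ _ => StrongDual.norm_le_norm_of_nonneg_of_le (X := X)) StrongDual.exists_nonneg_ge ξ
  simpa using (h η h0).sub (h (η - ξ) fun g hg => sub_nonneg.mpr (h1 g hg))

/-- Take a nonzero `ξ` and a positive majorant of it: if the majorant is 0, then `-ξ` is positive.
-/
theorem StrongDual.exists_nonneg_ne_zero (X : Type*) [NormedAddCommGroup X] [NormedSpace ℝ X]
    [Lattice X] [IsOrderedAddMonoid X] [HasSolidNorm X] [IsOrderedModule ℝ X] [Nontrivial X] :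
    ∃ f : StrongDual ℝ X, 0 ≤ f ∧ f ≠ 0 := by
  obtain ⟨x, hx⟩ := exists_ne (0 : X)
  obtain ⟨ξ, -, hξ⟩ := exists_dual_vector ℝ x (norm_ne_zero_iff.mpr hx)
  obtain ⟨η, h0, h1, -⟩ := StrongDual.exists_nonneg_ge ξ
  by_cases h : η = 0
  · refine ⟨-ξ, neg_nonneg.mpr (h ▸ h1), fun h2 => hx ?_⟩
    rw [neg_eq_zero.mp h2] at hξ
    simpa using hξ.symm
  · exact ⟨η, h0, h⟩

end BanachLattice

end PositiveFunctionals

/-! ### Sequences of positive multilinear forms -/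

section Multilinear

/-- Substitution of a functional on `E₀*` for the first variable of a multilinear form. -/
noncomputable def ContinuousMultilinearMap.evalFirst {m : ℕ} {E : Fin (m + 1) → Type u}
    [∀ i, NormedAddCommGroup (E i)] [∀ i, NormedSpace ℝ (E i)]
    (ξ : StrongDual ℝ (StrongDual ℝ (E 0))) :
    ContinuousMultilinearMap ℝ E ℝ →L[ℝ] ContinuousMultilinearMap ℝ (fun i : Fin m => E i.succ) ℝ :=
  (ContinuousLinearMap.compContinuousMultilinearMapL ℝ (fun i : Fin m => E i.succ)
      (StrongDual ℝ (E 0)) ℝ ξ).comp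
    ((ContinuousLinearMap.flipMultilinearEquiv ℝ (fun i : Fin m => E i.succ) (E 0)
        ℝ).toContinuousLinearMap.comp
      (continuousMultilinearCurryLeftEquiv ℝ E ℝ).toContinuousLinearEquiv.toContinuousLinearMap)

theorem ContinuousMultilinearMap.evalFirst_apply {m : ℕ} {E : Fin (m + 1) → Type u}
    [∀ i, NormedAddCommGroup (E i)] [∀ i, NormedSpace ℝ (E i)]
    (ξ : StrongDual ℝ (StrongDual ℝ (E 0))) (φ : ContinuousMultilinearMap ℝ E ℝ)
    (x : ∀ i : Fin m, E i.succ) :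
    evalFirst ξ φ x = ξ (φ.curryLeft.flipMultilinear x) := rfl

/-- Induction on the number of variables. Working in the space of multilinear forms keeps weak
nullity under slicing, since `evalFirst ξ` is a continuous linear map. -/
theorem ContinuousMultilinearMap.tendsto_apply_of_weaklyNull {m : ℕ} (E : Fin m → Type u)
    [∀ i, NormedAddCommGroup (E i)] [∀ i, NormedSpace ℝ (E i)] [∀ i, Lattice (E i)]
    [∀ i, IsOrderedAddMonoid (E i)] [∀ i, IsOrderedModule ℝ (E i)] [∀ i, HasSolidNorm (E i)]
    (hE : ∀ i, HasPositiveSchurProperty (StrongDual ℝ (E i)))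
    (φ : ℕ → ContinuousMultilinearMap ℝ E ℝ) (hφ : ∀ n x, (∀ i, 0 ≤ x i) → 0 ≤ φ n x)
    (hweak : ∀ Θ : StrongDual ℝ (ContinuousMultilinearMap ℝ E ℝ),
      Tendsto (fun n => Θ (φ n)) atTop (𝓝 0))
    (x : ℕ → ∀ i, E i) (hx : ∀ n i, 0 ≤ x n i) (hx1 : ∀ n i, ‖x n i‖ ≤ 1) :
    Tendsto (fun n => φ n (x n)) atTop (𝓝 0) := by
  induction m with
  | zero =>
    -- With no variables there is only one point, and evaluation there is a continuous functional.
    refine (hweak (ContinuousMultilinearMap.apply ℝ E ℝ (x 0))).congr fun n => ?_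
    rw [ContinuousMultilinearMap.apply_apply, Subsingleton.elim (x 0) (x n)]
  | succ m ih =>
    let ψ : ℕ → StrongDual ℝ (E 0) := fun n =>
      (φ n).curryLeft.flipMultilinear fun i : Fin m => x n i.succ
    have hψ : ∀ n y, ψ n y = φ n (Fin.cons y fun i : Fin m => x n i.succ) := fun n y => rfl
    have hψ0 : ∀ n, 0 ≤ ψ n := fun n y hy => by
      rw [hψ]
      exact hφ n _ fun i => Fin.cases hy (fun i => hx n i.succ) i
    have hnorm : Tendsto (fun n => ‖ψ n‖) atTop (𝓝 0) := by
      -- Only positive `ξ` are tested: the induction hypothesis requires the forms `evalFirst ξ (φ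
      -- n)` to be positive.
      refine hE 0 ψ hψ0 (StrongDual.tendsto_of_forall_nonneg fun ξ hξ => ?_)
      refine ih (fun i : Fin m => E i.succ) (fun i => hE i.succ) (fun n => evalFirst ξ (φ n))
        (fun n y hy => ?_) (fun Θ => hweak (Θ.comp (evalFirst ξ))) (fun n i => x n i.succ)
        (fun n i => hx n _) fun n i => hx1 n _
      rw [evalFirst_apply]
      refine hξ _ fun z hz => ?_
      exact hφ n (Fin.cons z y) fun i => Fin.cases hz hy i
    refine squeeze_zero (fun n => hφ n _ (hx n)) (fun n => ?_) hnorm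
    have h1 : φ n (x n) = ψ n (x n 0) := by
      rw [hψ]
      congr 1
      exact (Fin.cons_self_tail (x n)).symm
    rw [h1]
    calc ψ n (x n 0) ≤ ‖ψ n‖ * ‖x n 0‖ := (le_abs_self _).trans ((ψ n).le_opNorm _)
      _ ≤ ‖ψ n‖ := mul_le_of_le_one_right (norm_nonneg _) (hx1 n 0)

end Multilinear

/-! ### Positive functionals on the positive projective tensor product -/

section Functionals

variable {ι : Type} [Fintype ι] [Nonempty ι] {E : ι → Type u}
  [∀ i, NormedAddCommGroup (E i)] [∀ i, NormedSpace ℝ (E i)] [∀ i, Lattice (E i)]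
  [∀ i, IsOrderedAddMonoid (E i)] [∀ i, IsOrderedModule ℝ (E i)]

open UniformSpace

namespace VectorLatticeTensor

theorem norm_tmul_le [∀ i, HasSolidNorm (E i)] (x : ∀ i, E i) : ‖tmul x‖ ≤ ∏ i, ‖x i‖ := by
  refine csInf_le (bddBelow_majorantSums _) ⟨1, fun _ i => |x i|, fun _ i => abs_nonneg _, ?_, ?_⟩
  · rw [Fin.sum_univ_one]
    exact (isMMorphism_tmul x).le
  · simp [norm_abs_eq_norm]

/-- By positivity `|F u|` is at most `F` of any majorant in the definition of `‖u‖`, so testing on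
positive elementary tensors is enough. -/
theorem abs_map_le_of_tmul_le {F : VectorLatticeTensor E →ₗ[ℝ] ℝ} (hF : ∀ u, 0 ≤ u → 0 ≤ F u)
    {M : ℝ} (hM : 0 ≤ M) (h : ∀ x : (∀ i, E i), (∀ i, 0 ≤ x i) → F (tmul x) ≤ M * ∏ i, ‖x i‖)
    (u : VectorLatticeTensor E) : |F u| ≤ M * ‖u‖ := by
  rw [norm_def, ← smul_eq_mul, ← Real.sInf_smul_of_nonneg hM]
  refine le_csInf ((majorantSums_nonempty u).smul_set) ?_
  rintro _ ⟨_, ⟨n, x, hx, hu, rfl⟩, rfl⟩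
  calc |F u| ≤ F |u| := abs_map_le_map_abs hF u
    _ ≤ F (∑ k, tmul (x k)) := map_le_map_of_nonneg hF hu
    _ = ∑ k, F (tmul (x k)) := map_sum _ _ _
    _ ≤ ∑ k, M * ∏ i, ‖x k i‖ := Finset.sum_le_sum fun k _ => h _ (hx k)
    _ = M • ∑ k, ∏ i, ‖x k i‖ := by rw [smul_eq_mul, Finset.mul_sum]

end VectorLatticeTensor

namespace PositiveProjectiveTensor

open VectorLatticeTensor

theorem coe_nonneg {u : VectorLatticeTensor E} (hu : 0 ≤ u) :
    0 ≤ (u : PositiveProjectiveTensor E) := by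
  rw [← sup_eq_right] at hu ⊢
  rw [← Completion.coe_zero, ← coe_sup, hu]

/-- A functional on the completion is positive if it is positive on the tensor product. -/
theorem strongDual_nonneg_of_coe {F : StrongDual ℝ (PositiveProjectiveTensor E)}
    (hF : ∀ u : VectorLatticeTensor E, 0 ≤ u → 0 ≤ F u) : 0 ≤ F := by
  -- A positive `a` equals `0 ⊔ a`, which depends continuously on `a`, so density applies.
  have key : ∀ a : PositiveProjectiveTensor E, 0 ≤ F (0 ⊔ a) := fun a =>
    Completion.induction_on a
      (isClosed_le continuous_const (F.continuous.comp (continuous_sup continuous_const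
        continuous_id)))
      fun u => by
        rw [← Completion.coe_zero, ← coe_sup]
        exact hF _ le_sup_left
  intro a ha
  simpa [sup_eq_right.mpr ha] using key a

theorem norm_strongDual_le {F : StrongDual ℝ (PositiveProjectiveTensor E)} (hF : 0 ≤ F)
    {M : ℝ} (hM : 0 ≤ M) (h : ∀ x : (∀ i, E i), (∀ i, 0 ≤ x i) →
      F (tmul x : VectorLatticeTensor E) ≤ M * ∏ i, ‖x i‖) : ‖F‖ ≤ M := by
  refine F.opNorm_le_bound hM fun a => Completion.induction_on a
    (isClosed_le F.continuous.norm (continuous_const.mul continuous_norm)) fun u => ?_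
  rw [Completion.norm_coe]
  exact abs_map_le_of_tmul_le (F := F.toLinearMap ∘ₗ Completion.toComplL.toLinearMap)
    (fun u hu => hF _ (coe_nonneg hu)) hM h u

/-- Bounded positive functionals on the tensor product extend to the completion. -/
theorem exists_strongDual_extending {F : VectorLatticeTensor E →ₗ[ℝ] ℝ}
    (hF : ∀ u, 0 ≤ u → 0 ≤ F u) {M : ℝ} (hM : 0 ≤ M)
    (h : ∀ x : (∀ i, E i), (∀ i, 0 ≤ x i) → F (tmul x) ≤ M * ∏ i, ‖x i‖) :
    ∃ F' : StrongDual ℝ (PositiveProjectiveTensor E), 0 ≤ F' ∧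
      ∀ u : VectorLatticeTensor E, F' u = F u := by
  let G : VectorLatticeTensor E →L[ℝ] ℝ := F.mkContinuous M (abs_map_le_of_tmul_le hF hM h)
  let e : VectorLatticeTensor E →L[ℝ] PositiveProjectiveTensor E := Completion.toComplL
  have hG : ∀ u : VectorLatticeTensor E, G.extend e u = F u := fun u =>
    G.extend_eq (e := e) Completion.denseRange_coe (Completion.isUniformInducing_coe _) u
  exact ⟨G.extend e, strongDual_nonneg_of_coe fun u hu => (hG u).symm ▸ hF u hu, hG⟩

theorem exists_strongDual_tmul_eq_prod (f : ∀ i, StrongDual ℝ (E i)) (hf : ∀ i, 0 ≤ f i) :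
    ∃ F : StrongDual ℝ (PositiveProjectiveTensor E), 0 ≤ F ∧
      ∀ x : (∀ i, E i), F (tmul x : VectorLatticeTensor E) = ∏ i, f i (x i) := by
  obtain ⟨F, hF, hF'⟩ := exists_linearMap_tmul_eq_prod (fun i => (f i).toLinearMap) hf
  obtain ⟨F', h0, h1⟩ := exists_strongDual_extending hF (M := ∏ i, ‖f i‖)
    (Finset.prod_nonneg fun _ _ => norm_nonneg _) fun x hx => by
      rw [hF', ← Finset.prod_mul_distrib]
      exact Finset.prod_le_prod (fun i _ => hf i _ (hx i)) fun i _ =>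
        (le_abs_self _).trans ((f i).le_opNorm _)
  exact ⟨F', h0, fun x => (h1 _).trans (hF' x)⟩

/-- The elementary tensor as a continuous multilinear map into the completion. -/
noncomputable def tmulCLM [∀ i, HasSolidNorm (E i)] :
    ContinuousMultilinearMap ℝ E (PositiveProjectiveTensor E) :=
  ((Completion.toComplL (𝕜 := ℝ) (E := VectorLatticeTensor E)).toLinearMap.compMultilinearMap
    tmul).mkContinuous 1 fun x => by
      rw [one_mul]
      exact (Completion.norm_coe (tmul x)).trans_le (norm_tmul_le x)

omit [Fintype ι] [Nonempty ι] [∀ i, IsOrderedModule ℝ (E i)] in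
theorem tmul_nonneg {x : ∀ i, E i} (hx : ∀ i, 0 ≤ x i) : 0 ≤ (tmul x : VectorLatticeTensor E) := by
  have := isMMorphism_tmul x
  simp only [abs_of_nonneg (hx _)] at this
  exact this ▸ abs_nonneg _

end PositiveProjectiveTensor

end Functionals

/-! ### The two implications -/

namespace PositiveProjectiveTensor

open UniformSpace VectorLatticeTensor

variable {ι : Type} [Fintype ι] [Nonempty ι] {E : ι → Type u}
  [∀ i, NormedAddCommGroup (E i)] [∀ i, NormedSpace ℝ (E i)] [∀ i, Lattice (E i)]
  [∀ i, IsOrderedAddMonoid (E i)] [∀ i, IsOrderedModule ℝ (E i)]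

/-- A positive functional is normed up to a factor `2` by a positive elementary tensor. -/
theorem exists_half_norm_le {F : StrongDual ℝ (PositiveProjectiveTensor E)} (hF : 0 ≤ F) :
    ∃ x : (∀ i, E i), (∀ i, 0 ≤ x i) ∧ (∀ i, ‖x i‖ ≤ 1) ∧
      ‖F‖ / 2 ≤ F (tmul x : VectorLatticeTensor E) := by
  by_contra! h
  have h1 : ‖F‖ ≤ ‖F‖ / 2 := by
    refine norm_strongDual_le hF (by positivity) fun x hx => ?_
    -- Normalization needs no exception for `x i = 0`, as `0⁻¹ = 0`.
    have h2 : (fun i => ‖x i‖ • ‖x i‖⁻¹ • x i) = x := funext fun i => by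
      rcases eq_or_ne (x i) 0 with h0 | h0
      · simp [h0]
      · rw [smul_inv_smul₀ (norm_ne_zero_iff.mpr h0)]
    have h3 := h (fun i => ‖x i‖⁻¹ • x i) (fun i => smul_nonneg (by positivity) (hx i)) fun i => by
      rw [norm_smul, norm_inv, norm_norm]
      exact inv_mul_le_one
    conv_lhs => rw [← h2, MultilinearMap.map_smul_univ, Completion.coe_smul, map_smul, smul_eq_mul]
    rw [mul_comm]
    exact mul_le_mul_of_nonneg_right h3.le (Finset.prod_nonneg fun _ _ => norm_nonneg _)
  -- The strict inequality at the zero vectors gives `0 < ‖F‖`, contradicting `h1`.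
  have h4 := h 0 (fun i => le_rfl) fun i => by simp
  have h5 : 0 ≤ F (tmul 0 : VectorLatticeTensor E) := hF _ (coe_nonneg (tmul_nonneg fun i => le_rfl))
  linarith [norm_nonneg F]

/-- The elements of `E i*` that have a positive extension, along fixed functionals on the other
factors, at which `Θ` is bounded below are bounded away from `0`; hence positive extensions of
weakly null sequences are weakly null. -/
theorem not_frequently_le_of_weaklyNull [DecidableEq ι] (i : ι) {g : ∀ j, StrongDual ℝ (E j)}
    {f : ℕ → StrongDual ℝ (E i)}
    (hweak : ∀ ξ : StrongDual ℝ (StrongDual ℝ (E i)), Tendsto (fun n => ξ (f n)) atTop (𝓝 0))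
    {F : ℕ → StrongDual ℝ (PositiveProjectiveTensor E)} (hF : ∀ n, 0 ≤ F n)
    (hFf : ∀ n (x : ∀ j, E j), F n (tmul x : VectorLatticeTensor E) =
      f n (x i) * ∏ j ∈ Finset.univ.erase i, g j (x j))
    (Θ : StrongDual ℝ (StrongDual ℝ (PositiveProjectiveTensor E))) {ε : ℝ} (hε : 0 < ε) :
    ¬ ∃ᶠ n in atTop, ε ≤ Θ (F n) := by
  intro hfreq
  -- The extensions `F n` need not depend linearly on `f n`, so `Θ` cannot simply be pulled back to
  -- the dual of `E i`. Convexity of `Q` replaces linearity.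
  let Q : Set (StrongDual ℝ (E i)) := {a | ∃ b : StrongDual ℝ (PositiveProjectiveTensor E), 0 ≤ b ∧
    (∀ x : (∀ j, E j), b (tmul x : VectorLatticeTensor E) =
      a (x i) * ∏ j ∈ Finset.univ.erase i, g j (x j)) ∧ ε ≤ Θ b}
  have hQ : Convex ℝ Q := by
    rintro a ⟨b, hb, hba, hbΘ⟩ a' ⟨b', hb', hba', hbΘ'⟩ s t hs ht hst
    refine ⟨s • b + t • b', fun u hu => ?_, fun x => ?_, ?_⟩
    · exact add_nonneg (mul_nonneg hs (hb u hu)) (mul_nonneg ht (hb' u hu))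
    · simp only [add_apply, smul_apply, smul_eq_mul, hba,
        hba']
      ring
    · rw [map_add, map_smul, map_smul, smul_eq_mul, smul_eq_mul]
      calc ε = s * ε + t * ε := by rw [← add_mul, hst, one_mul]
        _ ≤ _ := by gcongr
  let C := ∏ j ∈ Finset.univ.erase i, ‖g j‖
  have hC : 0 ≤ C := Finset.prod_nonneg fun _ _ => norm_nonneg _
  -- Any positive extension of `a` has norm at most `‖a‖ * C`, so `a` cannot be small.
  have hbound : ∀ a ∈ Q, ε ≤ ‖Θ‖ * (‖a‖ * C) := by
    rintro a ⟨b, hb, hba, hbΘ⟩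
    refine hbΘ.trans ((le_abs_self _).trans ((Θ.le_opNorm b).trans ?_))
    refine mul_le_mul_of_nonneg_left (norm_strongDual_le hb (by positivity) fun x _ => ?_)
      (norm_nonneg _)
    rw [hba, ← Finset.mul_prod_erase _ (fun j => ‖x j‖) (Finset.mem_univ i), mul_mul_mul_comm,
      ← Finset.prod_mul_distrib]
    refine (le_abs_self _).trans ?_
    rw [abs_mul, Finset.abs_prod]
    refine mul_le_mul (a.le_opNorm _) (Finset.prod_le_prod (fun _ _ => abs_nonneg _)
      fun j _ => (g j).le_opNorm _) (Finset.prod_nonneg fun _ _ => abs_nonneg _) (by positivity)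
  -- The summand 1 keeps the denominator positive.
  let r := ε / (‖Θ‖ * C + 1)
  have hr : 0 < r := by positivity
  have hdisj : Disjoint (Metric.ball (0 : StrongDual ℝ (E i)) r) Q := by
    refine Set.disjoint_left.mpr fun a ha haQ => ?_
    rw [mem_ball_zero_iff, lt_div_iff₀ (by positivity)] at ha
    nlinarith [hbound a haQ, norm_nonneg a]
  obtain ⟨ξ, s, h1, h2⟩ := geometric_hahn_banach_open (convex_ball 0 r) Metric.isOpen_ball hQ hdisj
  -- The separating `ξ` is at least `s > 0` on `Q`, hence at infinitely many `f n`.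
  have hs : 0 < s := by simpa using h1 0 (Metric.mem_ball_self hr)
  obtain ⟨n, hn, hn'⟩ := (hfreq.and_eventually ((hweak ξ).eventually_lt_const hs)).exists
  exact absurd (h2 (f n) ⟨F n, hF n, hFf n, hn⟩) (not_le.mpr hn')

/-- Weak nullity passes up from `f n` to its tensor product `F n` with positive `g j`; norm nullity
passes back down by evaluating at fixed `e j` with `g j (e j) ≠ 0` in the other variables. -/
theorem hasPositiveSchurProperty_factor [∀ i, HasSolidNorm (E i)] [∀ i, Nontrivial (E i)]
    (h : HasPositiveSchurProperty (StrongDual ℝ (PositiveProjectiveTensor E))) (i : ι) :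
    HasPositiveSchurProperty (StrongDual ℝ (E i)) := by
  classical
  intro f hf hweak
  choose g hg hg0 using fun j => StrongDual.exists_nonneg_ne_zero (E j)
  choose e he using fun j => DFunLike.exists_ne (hg0 j)
  have hprod : ∀ n (x : ∀ j, E j), ∏ j, Function.update g i (f n) j (x j) =
      f n (x i) * ∏ j ∈ Finset.univ.erase i, g j (x j) := fun n x => by
    rw [← Finset.mul_prod_erase _ _ (Finset.mem_univ i), Function.update_self]
    congr 1
    exact Finset.prod_congr rfl fun j hj => by
      rw [Function.update_of_ne (Finset.ne_of_mem_erase hj)]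
  choose F hF hFf using fun n => exists_strongDual_tmul_eq_prod (Function.update g i (f n))
    fun j => by
      rcases eq_or_ne j i with rfl | hj
      · rw [Function.update_self]
        exact hf n
      · rw [Function.update_of_ne hj]
        exact hg j
  simp only [hprod] at hFf
  have hlt : ∀ (Θ : StrongDual ℝ (StrongDual ℝ (PositiveProjectiveTensor E))) (ε : ℝ), 0 < ε →
      ∀ᶠ n in atTop, Θ (F n) < ε := fun Θ ε hε => by
    simpa only [not_frequently, not_le] using not_frequently_le_of_weaklyNull i hweak hF hFf Θ hε
  have hF0 : Tendsto (fun n => ‖F n‖) atTop (𝓝 0) := by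
    refine h F hF fun Θ => ?_
    rw [Metric.tendsto_nhds]
    intro ε hε
    -- The separation argument is one-sided, so it is used for both `Θ` and `-Θ`.
    filter_upwards [hlt Θ ε hε, hlt (-Θ) ε hε] with n h1 h2
    rw [Real.dist_eq, sub_zero]
    exact abs_lt.mpr ⟨neg_lt.mp h2, h1⟩
  let c := ∏ j ∈ Finset.univ.erase i, g j (e j)
  have hc : 0 < |c| := abs_pos.mpr (Finset.prod_ne_zero_iff.mpr fun j _ => he j)
  let D := ∏ j ∈ Finset.univ.erase i, ‖e j‖
  have hD : 0 ≤ D := Finset.prod_nonneg fun _ _ => norm_nonneg _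
  refine squeeze_zero (fun n => norm_nonneg _) (fun n => ?_)
    (by simpa using (hF0.mul_const D).div_const |c|)
  refine (f n).opNorm_le_bound (by positivity) fun y => ?_
  have h1 : ∀ j ∈ Finset.univ.erase i, Function.update e i y j = e j := fun j hj =>
    Function.update_of_ne (Finset.ne_of_mem_erase hj) _ _
  have h2 : |f n y| * |c| = ‖F n (tmul (Function.update e i y) : VectorLatticeTensor E)‖ := by
    rw [hFf, Function.update_self, Real.norm_eq_abs, abs_mul]
    congr 2
    exact Finset.prod_congr rfl fun j hj => by rw [h1 j hj]
  have h3 : ‖tmul (Function.update e i y)‖ ≤ ‖y‖ * D := by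
    refine (norm_tmul_le _).trans_eq ?_
    rw [← Finset.mul_prod_erase _ _ (Finset.mem_univ i), Function.update_self]
    congr 1
    exact Finset.prod_congr rfl fun j hj => by rw [h1 j hj]
  rw [Real.norm_eq_abs, div_mul_eq_mul_div, le_div_iff₀ hc, h2]
  refine ((F n).le_opNorm _).trans ?_
  rw [Completion.norm_coe]
  calc ‖F n‖ * ‖tmul (Function.update e i y)‖ ≤ ‖F n‖ * (‖y‖ * D) := by gcongr
    _ = ‖F n‖ * D * ‖y‖ := by ring

theorem hasPositiveSchurProperty_of_factors {m : ℕ} [NeZero m] {E : Fin m → Type u}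
    [∀ i, NormedAddCommGroup (E i)] [∀ i, NormedSpace ℝ (E i)] [∀ i, Lattice (E i)]
    [∀ i, IsOrderedAddMonoid (E i)] [∀ i, IsOrderedModule ℝ (E i)] [∀ i, HasSolidNorm (E i)]
    (h : ∀ i, HasPositiveSchurProperty (StrongDual ℝ (E i))) :
    HasPositiveSchurProperty (StrongDual ℝ (PositiveProjectiveTensor E)) := by
  intro F hF hweak
  choose x hx hx1 hxF using fun n => exists_half_norm_le (hF n)
  -- Restriction to elementary tensors is continuous and linear, so it preserves weak nullity.
  let R : StrongDual ℝ (PositiveProjectiveTensor E) →L[ℝ] ContinuousMultilinearMap ℝ E ℝ :=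
    ContinuousLinearMap.flip (ContinuousLinearMap.compContinuousMultilinearMapL ℝ E
      (PositiveProjectiveTensor E) ℝ) tmulCLM
  have hR := ContinuousMultilinearMap.tendsto_apply_of_weaklyNull E h (fun n => R (F n))
    (fun n y hy => hF n _ (coe_nonneg (tmul_nonneg hy))) (fun Θ => hweak (Θ.comp R)) x hx hx1
  refine squeeze_zero (fun n => norm_nonneg _) (fun n => ?_) (by simpa using hR.const_mul 2)
  have : R (F n) (x n) = F n (tmul (x n) : VectorLatticeTensor E) := rfl
  linarith [hxF n]

end PositiveProjectiveTensor

theorem proposition4p3 (m : ℕ) [NeZero m] (E : Fin m → Type u)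
    [∀ i, NormedAddCommGroup (E i)] [∀ i, NormedSpace ℝ (E i)] [∀ i, CompleteSpace (E i)]
    [∀ i, Lattice (E i)] [∀ i, IsOrderedAddMonoid (E i)] [∀ i, IsOrderedModule ℝ (E i)]
    [∀ i, HasSolidNorm (E i)] [∀ i, Nontrivial (E i)] :
    HasPositiveSchurProperty (StrongDual ℝ (PositiveProjectiveTensor E)) ↔
      ∀ i, HasPositiveSchurProperty (StrongDual ℝ (E i)) :=
  ⟨fun h i => PositiveProjectiveTensor.hasPositiveSchurProperty_factor h i,
    PositiveProjectiveTensor.hasPositiveSchurProperty_of_factors⟩
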